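/- Consider the class of equations $$u_t+uu_x+\beta(t)u_{xxx}+\sigma(t)u_{xxxxx}=0,$$ where the arbitrary elements $\beta,\sigma$ are smooth nonvanishing real functions of $t$ on an open interval. The usual equivalence group of this class consists of the nondegenerate (smooth, with invertible differential) point transformations of $(t,x,u,\beta,\sigma)$ whose $(t,x,u)$-components depend on $(t,x,u)$ only and which map every equation of the class to an equation of the same class, i.e. such that their prolongation maps the submanifold of the fifth-order jet space defined by the initial equation to the one defined by the transformed equation. Transformations are considered over a nonempty connected open set $\Omega$ of points $(t,x,u)$ and for all nonzero values of $\beta$ and $\sigma$. The usual equivalence group consists precisely of the transformations $$\tilde t=\frac{at+b}{ct+d},\qquad \tilde x=\frac{e_2x+e_1t+e_0}{ct+d},\qquad \tilde u=\frac{e_2(ct+d)u-e_2cx-e_0c+e_1d}{\Delta},$$ $$\tilde\beta=\frac{e_2^3}{ct+d}\,\frac{\beta}{\Delta},\qquad \tilde\sigma=\frac{e_2^5}{(ct+d)^3}\,\frac{\sigma}{\Delta},$$ where $a,b,c,d,e_0,e_1,e_2$ are arbitrary real constants with $\Delta=ad-bc\neq0$ and $e_2\neq0$, and $ct+d\ne0$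 over $\Omega$. The tuple $(a,b,c,d,e_0,e_1,e_2)$ is determined by the transformation exactly up to a nonzero real multiplier, and hence it can be chosen with $\Delta=\pm1$. -/

import Mathlib

open scoped ContDiff Topology

namespace Kawahara

/-- An equation `u_t + u u_x + β(t) u_xxx + σ(t) u_xxxxx = 0` of the class: the arbitrary elements
`β` and `σ` are smooth nonvanishing functions of `t` on a nonempty open interval `I`. -/
structure Equation where
  I : Set ℝ
  β : ℝ → ℝ
  σ : ℝ → ℝ
  isOpen_I : IsOpen I
  ordConnected_I : I.OrdConnected
  nonempty_I : I.Nonempty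
  smooth_β : ContDiffOn ℝ ∞ β I
  smooth_σ : ContDiffOn ℝ ∞ σ I
  β_ne_zero : ∀ t ∈ I, β t ≠ 0
  σ_ne_zero : ∀ t ∈ I, σ t ≠ 0

/-- The left-hand side `u_t + u u_x + β u_xxx + σ u_xxxxx` at the point `q = (t, x)`. For a smooth
`u` it is the value, at the 5-jet of `u` at `q`, of the function that defines the equation as a
submanifold of the fifth-order jet space. -/
noncomputable def Equation.lhs (E : Equation) (u : ℝ × ℝ → ℝ) (q : ℝ × ℝ) : ℝ :=
  deriv (fun s => u (s, q.2)) q.1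
    + u q * deriv (fun y => u (q.1, y)) q.2
    + E.β q.1 * iteratedDeriv 3 (fun y => u (q.1, y)) q.2
    + E.σ q.1 * iteratedDeriv 5 (fun y => u (q.1, y)) q.2

/-- A transformation of the variables and the arbitrary elements,
`t̃ = T(t,x,u)`, `x̃ = X(t,x,u)`, `ũ = U(t,x,u)`, `β̃ = B(t,x,u,β,σ)`, `σ̃ = S(t,x,u,β,σ)`,
whose components for the variables are projectible on the space of `(t,x,u)`. -/
structure Transformation where
  T : ℝ × ℝ × ℝ → ℝ
  X : ℝ × ℝ × ℝ → ℝ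
  U : ℝ × ℝ × ℝ → ℝ
  B : (ℝ × ℝ × ℝ) × ℝ × ℝ → ℝ
  S : (ℝ × ℝ × ℝ) × ℝ × ℝ → ℝ

namespace Transformation

/-- The whole transformation of the space of `((t,x,u),β,σ)`. -/
def toMap (Φ : Transformation) (q : (ℝ × ℝ × ℝ) × ℝ × ℝ) : (ℝ × ℝ × ℝ) × ℝ × ℝ :=
  ((Φ.T q.1, Φ.X q.1, Φ.U q.1), Φ.B q, Φ.S q)

/-- For `(t,x,u)` in `Ω`, all nonzero values of the arbitrary elements are admitted. -/
def extendedDomain (Ω : Set (ℝ × ℝ × ℝ)) : Set ((ℝ × ℝ × ℝ) × ℝ × ℝ) :=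
  {q | q.1 ∈ Ω ∧ q.2.1 ≠ 0 ∧ q.2.2 ≠ 0}

/-- `Φ` is a nondegenerate (smooth, with everywhere invertible differential) point transformation
of the variables `(t,x,u)` in `Ω` and of the arbitrary elements `β`, `σ`. -/
def IsNondegenerate (Φ : Transformation) (Ω : Set (ℝ × ℝ × ℝ)) : Prop :=
  ContDiffOn ℝ ∞ Φ.toMap (extendedDomain Ω) ∧
    ∀ q ∈ extendedDomain Ω, Function.Bijective (fderiv ℝ Φ.toMap q)

/-- The new independent variables as functions of the old ones along the graph of `u`. -/
def newIndep (Φ : Transformation) (u : ℝ × ℝ → ℝ) (q : ℝ × ℝ) : ℝ × ℝ :=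
  (Φ.T (q.1, q.2, u q), Φ.X (q.1, q.2, u q))

/-- The prolongation of `Φ` to 5-jets maps the 5-jet of `u` at `q` to the 5-jet of `v` at
`newIndep u q`: near `q` the graph of `u` goes over into the graph of the function `v`. The point
transformation acts on those jets on which the total Jacobian matrix of the new independent
variables is invertible. -/
def MapsJet (Φ : Transformation) (u v : ℝ × ℝ → ℝ) (q : ℝ × ℝ) : Prop :=
  ContDiffAt ℝ ∞ u q ∧
    Function.Bijective (fderiv ℝ (Φ.newIndep u) q) ∧
    ContDiffAt ℝ ∞ v (Φ.newIndep u q) ∧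
    ∀ᶠ r in 𝓝 q, v (Φ.newIndep u r) = Φ.U (r.1, r.2, u r)

/-- `Φ` maps the equation `E` to the equation `E'` over `Ω`: the arbitrary elements of `E'` are
those that `Φ` prescribes, and the prolonged point transformation carries the submanifold of the
jet space given by `E` to the one given by `E'`. -/
def MapsEquation (Φ : Transformation) (Ω : Set (ℝ × ℝ × ℝ)) (E E' : Equation) : Prop :=
  (∀ p ∈ Ω, p.1 ∈ E.I →
    Φ.T p ∈ E'.I ∧
    E'.β (Φ.T p) = Φ.B (p, E.β p.1, E.σ p.1) ∧
    E'.σ (Φ.T p) = Φ.S (p, E.β p.1, E.σ p.1)) ∧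
  ∀ (q : ℝ × ℝ) (u v : ℝ × ℝ → ℝ), q.1 ∈ E.I → (q.1, q.2, u q) ∈ Ω → Φ.MapsJet u v q →
    (E.lhs u q = 0 ↔ E'.lhs v (Φ.newIndep u q) = 0)

/-- `Φ`, considered over `Ω`, belongs to the usual equivalence group of the class: it is a
nondegenerate point transformation of the variables and the arbitrary elements, and maps every
equation of the class to an equation of the class. -/
def IsUsualEquivalence (Φ : Transformation) (Ω : Set (ℝ × ℝ × ℝ)) : Prop :=
  Φ.IsNondegenerate Ω ∧ ∀ E : Equation, ∃ E' : Equation, Φ.MapsEquation Ω E E'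

end Transformation

/-- Tuples `(a, b, c, d, e₀, e₁, e₂)` of real constants. -/
structure Params where
  a : ℝ
  b : ℝ
  c : ℝ
  d : ℝ
  e₀ : ℝ
  e₁ : ℝ
  e₂ : ℝ

namespace Params

/-- `Δ = ad - bc`. -/
def Δ (k : Params) : ℝ := k.a * k.d - k.b * k.c

/-- The tuple multiplied by the number `m`. -/
def scale (m : ℝ) (k : Params) : Params :=
  ⟨m * k.a, m * k.b, m * k.c, m * k.d, m * k.e₀, m * k.e₁, m * k.e₂⟩

/-- Over `Ω` (where `ct + d` must not vanish) the transformation `Φ` is given by the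
projective-type formulas with the constants `k`, subject to `Δ ≠ 0` and `e₂ ≠ 0`. -/
def Describes (k : Params) (Φ : Transformation) (Ω : Set (ℝ × ℝ × ℝ)) : Prop :=
  k.Δ ≠ 0 ∧ k.e₂ ≠ 0 ∧
  ∀ t x u : ℝ, (t, x, u) ∈ Ω →
    k.c * t + k.d ≠ 0 ∧
    Φ.T (t, x, u) = (k.a * t + k.b) / (k.c * t + k.d) ∧
    Φ.X (t, x, u) = (k.e₂ * x + k.e₁ * t + k.e₀) / (k.c * t + k.d) ∧
    Φ.U (t, x, u) =
      (k.e₂ * (k.c * t + k.d) * u - k.e₂ * k.c * x - k.e₀ * k.c + k.e₁ * k.d) / k.Δ ∧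
    ∀ β σ : ℝ, β ≠ 0 → σ ≠ 0 →
      Φ.B ((t, x, u), β, σ) = k.e₂ ^ 3 / (k.c * t + k.d) * (β / k.Δ) ∧
      Φ.S ((t, x, u), β, σ) = k.e₂ ^ 5 / (k.c * t + k.d) ^ 3 * (σ / k.Δ)

end Params

end Kawahara

/-! Necessity is the direct method. An equivalence must work for every equation at once, so at a
fixed point of `Ω` the values of `β`, `σ` and of `u_x`, `u_xxx`, `u_xxxx`, `u_xxxxx` are free, `u_t`
being solved from the equation. The transformed equation therefore splits with respect to them.
Polynomial test functions realise the jets, and the inverse function theorem supplies the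
transformed function `v`.

The new coefficients are functions of `t̃` alone, while the slopes of `β` and `σ` at a given `t` are
arbitrary; with nondegeneracy this forces `T = T(t)` (`fderiv_T_eq_zero`). The coefficient of
`u_xxxxx` gives `T_t σ̃ = σ (D_x X)^5` (`symbol`), whence `X_u = 0` and `X_xx = 0`. The coefficient
of `u_xxxx` gives `U_xu = U_uu = 0` (`dx_du_U_add`). What remains (`exists_determining`) is `T_t S =
σ X_x^5`, `T_t B = β X_x^3`, `X_t + u X_x = T_t U` and `U_t + u U_x = 0`.

Differentiating the last two shows that `U_x` is constant, that `U_u` is affine in `t` and that `T_t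
U_u^2` is constant. So `T` is fractional linear with denominator `U_u`, and `X` and `U` follow
(`exists_describes`).

Sufficiency is a computation: under the formulas the left-hand side of the equation is multiplied by
the nonvanishing factor `e₂ (ct+d)^3 / Δ^2` (`lhs_iff`). The tuple is recovered up to a multiplier
from the values and first derivatives at one point (`eq_scale`), and the multiplier changes `Δ` by a
square. -/

open Filter Asymptotics

namespace Kawahara

/-! ### Taylor jets of functions of one variable. -/

section Jets

/-- A smooth function that vanishes to order higher than `n` has vanishing `n`-jet. -/
theorem iteratedDeriv_eq_zero_of_isLittleO {f : ℝ → ℝ} {y : ℝ} {n : ℕ}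
    (hf : ContDiffAt ℝ n f y) (ho : f =o[𝓝 y] fun x => (x - y) ^ n) (k : ℕ) (hk : k ≤ n) :
    iteratedDeriv k f y = 0 := by
  induction k using Nat.strong_induction_on with
  | _ k ih =>
  obtain ⟨s, hs, hfs⟩ := (hf.of_le (by exact_mod_cast hk : (k : ℕ∞ω) ≤ n)).contDiffOn le_rfl (by simp)
  obtain ⟨r, hr, hrs⟩ := Metric.mem_nhds_iff.1 hs
  have hy : y ∈ Metric.ball y r := Metric.mem_ball_self hr
  have ht := taylor_isLittleO (convex_ball y r) hy (hfs.mono hrs)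
  rw [Metric.isOpen_ball.nhdsWithin_eq hy] at ht
  have hb : f =o[𝓝 y] fun x => (x - y) ^ k := by
    refine ho.trans_isBigO ?_
    have : (fun x : ℝ => (x - y) ^ n) = fun x => (x - y) ^ (n - k) * (x - y) ^ k := by
      funext x; rw [← pow_add, Nat.sub_add_cancel hk]
    rw [this]
    have h1 : (fun x : ℝ => (x - y) ^ (n - k)) =O[𝓝 y] fun _ => (1 : ℝ) :=
      Continuous.continuousAt (by fun_prop) |>.isBigO_one ℝ
    simpa using h1.mul (isBigO_refl (fun x : ℝ => (x - y) ^ k) (𝓝 y))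
  have hd := hb.sub ht
  -- By induction the lower derivatives vanish, so the Taylor polynomial of degree `k` is its top
  -- monomial; being `o` of `(x - y) ^ k`, it must be zero.
  have he : (fun x => f x - (f x - taylorWithinEval f k (Metric.ball y r) y x)) =
      fun x => (iteratedDeriv k f y / k.factorial) * (x - y) ^ k := by
    funext x
    rw [sub_sub_cancel, taylor_within_apply, Finset.sum_range_succ, Finset.sum_eq_zero]
    · rw [iteratedDerivWithin_of_isOpen Metric.isOpen_ball hy]
      simp only [smul_eq_mul, zero_add]
      ring
    · intro j hj
      rw [iteratedDerivWithin_of_isOpen Metric.isOpen_ball hy,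
        ih j (Finset.mem_range.1 hj) ((Finset.mem_range.1 hj).le.trans hk)]
      simp
  rw [he] at hd
  by_contra hne
  have hc : iteratedDeriv k f y / k.factorial ≠ 0 := div_ne_zero hne (by positivity)
  have hd' := (isLittleO_const_mul_left_iff hc).1 hd
  have hfr : ∃ᶠ x in 𝓝 y, (x - y) ^ k ≠ 0 := by
    have : ∃ᶠ x in 𝓝[≠] y, (x - y) ^ k ≠ 0 := by
      apply Eventually.frequently
      filter_upwards [self_mem_nhdsWithin] with x hx
      exact pow_ne_zero _ (sub_ne_zero.2 hx)
    exact this.filter_mono nhdsWithin_le_nhds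
  exact isLittleO_irrefl hfr hd'

/-- The result keeps the shape of a quintic, with top coefficient `0`, so that `simp` can iterate
the rule. -/
theorem deriv_quintic (c₀ c₁ c₂ c₃ c₄ c₅ y : ℝ) :
    deriv (fun x => c₀ + c₁ * (x - y) + c₂ * (x - y) ^ 2 + c₃ * (x - y) ^ 3 + c₄ * (x - y) ^ 4 +
      c₅ * (x - y) ^ 5) =
    fun x => c₁ + (2 * c₂) * (x - y) + (3 * c₃) * (x - y) ^ 2 + (4 * c₄) * (x - y) ^ 3 +
      (5 * c₅) * (x - y) ^ 4 + 0 * (x - y) ^ 5 := by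
  funext x
  have h : HasDerivAt (fun x : ℝ => x - y) 1 x := (hasDerivAt_id x).sub_const y
  have := ((((h.const_mul c₁).const_add c₀).add ((h.pow 2).const_mul c₂)).add
    ((h.pow 3).const_mul c₃)).add ((h.pow 4).const_mul c₄) |>.add ((h.pow 5).const_mul c₅)
  refine this.deriv.trans ?_
  push_cast
  ring

theorem iteratedDeriv_quintic (c₀ c₁ c₃ c₄ c₅ y : ℝ) :
    deriv (fun x => c₀ + c₁ * (x - y) + 0 * (x - y) ^ 2 + c₃ * (x - y) ^ 3 + c₄ * (x - y) ^ 4 +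
      c₅ * (x - y) ^ 5) y = c₁ ∧
    iteratedDeriv 3 (fun x => c₀ + c₁ * (x - y) + 0 * (x - y) ^ 2 + c₃ * (x - y) ^ 3 +
      c₄ * (x - y) ^ 4 + c₅ * (x - y) ^ 5) y = 6 * c₃ ∧
    iteratedDeriv 5 (fun x => c₀ + c₁ * (x - y) + 0 * (x - y) ^ 2 + c₃ * (x - y) ^ 3 +
      c₄ * (x - y) ^ 4 + c₅ * (x - y) ^ 5) y = 120 * c₅ := by
  refine ⟨?_, ?_, ?_⟩
  · rw [deriv_quintic]; simp
  · simp only [iteratedDeriv_succ', deriv_quintic, iteratedDeriv_zero]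
    simp only [sub_self]; ring
  · simp only [iteratedDeriv_succ', deriv_quintic, iteratedDeriv_zero]
    simp only [sub_self]; ring

/-- Only orders 1, 3 and 5 enter the equation, and a quartic term contributes to none of them at
`y`. The case `a = 0` serves the coefficient of `u_xxxxx`, the case `a = U_u` that of `u_xxxx`. -/
theorem jet_eq_of_isLittleO {f g : ℝ → ℝ} {y a b : ℝ} (hf : ContDiffAt ℝ 5 f y)
    (hg : ContDiffAt ℝ 5 g y)
    (ho : (fun x => f x - g x - (a * (x - y) ^ 4 + b * (x - y) ^ 5)) =o[𝓝 y]
      fun x => (x - y) ^ 5) :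
    deriv f y = deriv g y ∧ iteratedDeriv 3 f y = iteratedDeriv 3 g y ∧
      iteratedDeriv 5 f y = iteratedDeriv 5 g y + 120 * b := by
  have hp : ContDiff ℝ 5 (fun x => a * (x - y) ^ 4 + b * (x - y) ^ 5) := by fun_prop
  have key : ∀ k : ℕ, k ≤ 5 → iteratedDeriv k f y = iteratedDeriv k g y +
      iteratedDeriv k (fun x => a * (x - y) ^ 4 + b * (x - y) ^ 5) y := by
    intro k hk
    have hk' : (k : ℕ∞ω) ≤ 5 := by exact_mod_cast hk
    have h0 := iteratedDeriv_eq_zero_of_isLittleO (n := 5)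
      ((hf.sub hg).sub hp.contDiffAt) ho k hk
    rw [show (fun x => f x - g x - (a * (x - y) ^ 4 + b * (x - y) ^ 5)) =
      (f - g) - fun x => a * (x - y) ^ 4 + b * (x - y) ^ 5 from rfl] at h0
    have hfg : ContDiffAt ℝ k (f - g) y := (hf.sub hg).of_le hk'
    rw [iteratedDeriv_sub hfg (hp.contDiffAt.of_le hk'),
      iteratedDeriv_sub (hf.of_le hk') (hg.of_le hk')] at h0
    linarith
  have he : (fun x => a * (x - y) ^ 4 + b * (x - y) ^ 5) = fun x => 0 + 0 * (x - y) +
      0 * (x - y) ^ 2 + 0 * (x - y) ^ 3 + a * (x - y) ^ 4 + b * (x - y) ^ 5 := by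
    funext x; ring
  obtain ⟨h1, h3, h5⟩ := iteratedDeriv_quintic 0 0 0 a b y
  rw [he] at key
  refine ⟨?_, ?_, ?_⟩
  · have := key 1 (by norm_num)
    simp only [iteratedDeriv_one] at this
    rw [this, h1, add_zero]
  · rw [key 3 (by norm_num), h3, mul_zero, add_zero]
  · rw [key 5 le_rfl, h5]

/-- The effect of an affine change of the independent variable on derivatives. -/
theorem iteratedDeriv_of_comp_affine {w η : ℝ → ℝ} {x₀ y₀ m : ℝ}
    (h : ∀ᶠ x in 𝓝 x₀, w (y₀ + m * (x - x₀)) = η x) (k : ℕ) :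
    m ^ k * iteratedDeriv k w y₀ = iteratedDeriv k η x₀ := by
  have hc : ∀ k : ℕ, iteratedDeriv k (fun x => w (y₀ + m * (x - x₀))) =
      fun x => m ^ k * iteratedDeriv k w (y₀ + m * (x - x₀)) := by
    intro k
    induction k with
    | zero => simp
    | succ k ih =>
      funext x
      rw [iteratedDeriv_succ, ih, deriv_const_mul_field, iteratedDeriv_succ]
      have h1 : deriv (fun x => iteratedDeriv k w (y₀ + m * (x - x₀))) x =
          m * deriv (iteratedDeriv k w) (y₀ + m * (x - x₀)) := by
        have h2 := deriv_comp_sub_const (fun z => iteratedDeriv k w (y₀ + m * z)) x₀ x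
        rw [h2]
        have h3 := deriv_comp_mul_left m (fun z => iteratedDeriv k w (y₀ + z)) (x - x₀)
        rw [h3, deriv_comp_const_add]
        simp
      rw [h1]; ring
  have h4 := Filter.EventuallyEq.iteratedDeriv_eq k
    (show (fun x => w (y₀ + m * (x - x₀))) =ᶠ[𝓝 x₀] η from h)
  rw [← h4, hc k]
  simp

/-- If two smooth functions take, along two curves that agree to fourth order, values that agree
to fourth order, then the difference of the functions is of fifth order. -/
theorem sub_isLittleO_of_comp {w₀ w₁ ξ₀ ξ₁ η₀ η₁ : ℝ → ℝ} {x₀ m A B ε w' : ℝ} (hm : m ≠ 0)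
    (hξ : HasStrictDerivAt ξ₀ m x₀) (hξ1 : ξ₁ x₀ = ξ₀ x₀)
    (hξc : ContinuousAt ξ₁ x₀)
    (hw : HasStrictDerivAt w₁ w' (ξ₀ x₀))
    (h0 : ∀ᶠ x in 𝓝 x₀, w₀ (ξ₀ x) = η₀ x) (h1 : ∀ᶠ x in 𝓝 x₀, w₁ (ξ₁ x) = η₁ x)
    (hδξ : (fun x => ξ₁ x - ξ₀ x - A * (ε * (x - x₀) ^ 5)) =o[𝓝 x₀] fun x => (x - x₀) ^ 5)
    (hδη : (fun x => η₁ x - η₀ x - B * (ε * (x - x₀) ^ 5)) =o[𝓝 x₀] fun x => (x - x₀) ^ 5) :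
    (fun y => w₁ y - w₀ y - (0 * (y - ξ₀ x₀) ^ 4 + ((B - w' * A) * ε / m ^ 5) * (y - ξ₀ x₀) ^ 5))
      =o[𝓝 (ξ₀ x₀)] fun y => (y - ξ₀ x₀) ^ 5 := by
  have hξO : (fun x => ξ₁ x - ξ₀ x) =O[𝓝 x₀] fun x => (x - x₀) ^ 5 := by
    have h := hδξ.isBigO.add ((isBigO_refl (fun x => (x - x₀) ^ 5) (𝓝 x₀)).const_mul_left (A * ε))
    refine h.congr_left fun x => by ring
  -- Both arguments of `w₁` move with `x`, which is why strict differentiability is needed.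
  have hw1 : (fun x => w₁ (ξ₁ x) - w₁ (ξ₀ x) - w' * (ξ₁ x - ξ₀ x)) =o[𝓝 x₀]
      fun x => (x - x₀) ^ 5 := by
    have ht : Tendsto (fun x => (ξ₁ x, ξ₀ x)) (𝓝 x₀) (𝓝 (ξ₀ x₀, ξ₀ x₀)) := by
      have := hξc.tendsto
      rw [hξ1] at this
      exact this.prodMk_nhds hξ.hasDerivAt.continuousAt
    have h := (hasStrictDerivAt_iff_hasStrictFDerivAt.1 hw).isLittleO.comp_tendsto ht
    refine IsLittleO.trans_isBigO ?_ hξO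
    refine h.congr_left fun x => ?_
    simp [mul_comm]
  have hlin : (fun x => ξ₀ x - ξ₀ x₀ - m * (x - x₀)) =o[𝓝 x₀] fun x => x - x₀ := by
    have := hξ.hasDerivAt.isLittleO
    refine this.congr_left fun x => ?_
    simp [mul_comm]
  have hlin1 : (fun x => ξ₀ x - ξ₀ x₀) =O[𝓝 x₀] fun x => x - x₀ := hξ.hasDerivAt.isBigO_sub
  have hlin2 : (fun x => x - x₀) =O[𝓝 x₀] fun x => ξ₀ x - ξ₀ x₀ := by
    have h := (isBigO_refl (fun x => x - x₀) (𝓝 x₀))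
    have h2 : (fun x => m * (x - x₀)) ~[𝓝 x₀] fun x => ξ₀ x - ξ₀ x₀ := by
      have : (fun x => ξ₀ x - ξ₀ x₀) ~[𝓝 x₀] fun x => m * (x - x₀) := by
        rw [IsEquivalent]
        exact (isLittleO_const_mul_right_iff hm).2 hlin
      exact this.symm
    exact (isBigO_const_mul_left_iff hm).1 h2.isBigO
  have hpow : (fun x => (m * (x - x₀)) ^ 5 - (ξ₀ x - ξ₀ x₀) ^ 5) =o[𝓝 x₀]
      fun x => (x - x₀) ^ 5 := by
    have hmO : (fun x => m * (x - x₀)) =O[𝓝 x₀] fun x => x - x₀ :=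
      (isBigO_refl _ _).const_mul_left m
    have hs : (fun x => (m * (x - x₀)) ^ 4 + (m * (x - x₀)) ^ 3 * (ξ₀ x - ξ₀ x₀) +
        (m * (x - x₀)) ^ 2 * (ξ₀ x - ξ₀ x₀) ^ 2 + (m * (x - x₀)) * (ξ₀ x - ξ₀ x₀) ^ 3 +
        (ξ₀ x - ξ₀ x₀) ^ 4) =O[𝓝 x₀] fun x => (x - x₀) ^ 4 := by
      refine ((((hmO.pow 4).add ?_).add ?_).add ?_).add (hlin1.pow 4)
      · exact ((hmO.pow 3).mul hlin1).congr_right fun x => by ring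
      · exact ((hmO.pow 2).mul (hlin1.pow 2)).congr_right fun x => by ring
      · exact (hmO.mul (hlin1.pow 3)).congr_right fun x => by ring
    refine (hlin.neg_left.mul_isBigO hs).congr (fun x => by ring) (fun x => by ring)
  -- Substitute `y = ξ₀ x`. Then `(w₁ - w₀)(ξ₀ x)` is `η₁ - η₀` minus `w₁ (ξ₁ x) - w₁ (ξ₀ x)`, that
  -- is `(B - w' A) ε (x - x₀)^5` up to smaller terms, and `m (x - x₀)` may be replaced by `y - ξ₀
  -- x₀`.
  rw [← hξ.map_nhds_eq hm, isLittleO_map]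
  refine IsLittleO.trans_isBigO ?_ (hlin2.pow 5)
  have hsum := (((hδη.sub hw1).sub (hδξ.const_mul_left w')).add
    (hpow.const_mul_left ((B - w' * A) * ε / m ^ 5)))
  refine hsum.congr' ?_ EventuallyEq.rfl
  filter_upwards [h0, h1] with x hx0 hx1
  simp only [Function.comp, hx0, hx1]
  field_simp
  ring

end Jets

/-! ### Partial derivatives and the chain rule along a graph. -/

section Partials

/-- The partial derivative with respect to `t`. -/
noncomputable def dt (F : ℝ × ℝ × ℝ → ℝ) (p : ℝ × ℝ × ℝ) : ℝ := fderiv ℝ F p (1, 0, 0)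

/-- The partial derivative with respect to `x`. -/
noncomputable def dx (F : ℝ × ℝ × ℝ → ℝ) (p : ℝ × ℝ × ℝ) : ℝ := fderiv ℝ F p (0, 1, 0)

/-- The partial derivative with respect to `u`. -/
noncomputable def du (F : ℝ × ℝ × ℝ → ℝ) (p : ℝ × ℝ × ℝ) : ℝ := fderiv ℝ F p (0, 0, 1)

theorem fderiv_eq_partials (F : ℝ × ℝ × ℝ → ℝ) (p : ℝ × ℝ × ℝ) (a b c : ℝ) :
    fderiv ℝ F p (a, b, c) = a * dt F p + b * dx F p + c * du F p := by
  have : ((a, b, c) : ℝ × ℝ × ℝ) = a • (1, 0, 0) + b • (0, 1, 0) + c • (0, 0, 1) := by simp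
  rw [this, map_add, map_add, map_smul, map_smul, map_smul]
  rfl

theorem fderiv_prod_eq_partials {v : ℝ × ℝ → ℝ} {z : ℝ × ℝ} (hv : DifferentiableAt ℝ v z)
    (a b : ℝ) : fderiv ℝ v z (a, b) =
      a * deriv (fun s => v (s, z.2)) z.1 + b * deriv (fun y => v (z.1, y)) z.2 := by
  have h1 : HasDerivAt (fun s => v (s, z.2)) (fderiv ℝ v z (1, 0)) z.1 :=
    HasFDerivAt.comp_hasDerivAt (f := fun s : ℝ => (s, z.2)) z.1 hv.hasFDerivAt
      ((hasDerivAt_id z.1).prodMk (hasDerivAt_const z.1 z.2))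
  have h2 : HasDerivAt (fun y => v (z.1, y)) (fderiv ℝ v z (0, 1)) z.2 :=
    HasFDerivAt.comp_hasDerivAt (f := fun y : ℝ => (z.1, y)) z.2 hv.hasFDerivAt
      ((hasDerivAt_const z.2 z.1).prodMk (hasDerivAt_id z.2))
  rw [h1.deriv, h2.deriv]
  have : ((a, b) : ℝ × ℝ) = a • (1, 0) + b • (0, 1) := by simp
  conv_lhs => rw [this, map_add, map_smul, map_smul]
  rfl

theorem hasDerivAt_comp_graph_left {F : ℝ × ℝ × ℝ → ℝ} {u : ℝ × ℝ → ℝ} {q : ℝ × ℝ}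
    (hF : DifferentiableAt ℝ F (q.1, q.2, u q)) (hu : DifferentiableAt ℝ u q) :
    HasDerivAt (fun s => F (s, q.2, u (s, q.2)))
      (dt F (q.1, q.2, u q) + deriv (fun s => u (s, q.2)) q.1 * du F (q.1, q.2, u q)) q.1 := by
  have h1 : HasDerivAt (fun s => u (s, q.2)) (deriv (fun s => u (s, q.2)) q.1) q.1 := by
    have : DifferentiableAt ℝ (fun s => u (s, q.2)) q.1 :=
      DifferentiableAt.comp (f := fun s : ℝ => (s, q.2)) q.1 hu (by fun_prop)
    exact this.hasDerivAt
  have h2 : HasDerivAt (fun s => (s, q.2, u (s, q.2)))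
      ((1, 0, deriv (fun s => u (s, q.2)) q.1) : ℝ × ℝ × ℝ) q.1 :=
    (hasDerivAt_id q.1).prodMk ((hasDerivAt_const q.1 q.2).prodMk h1)
  have h3 := HasFDerivAt.comp_hasDerivAt (f := fun s : ℝ => (s, q.2, u (s, q.2))) q.1
    hF.hasFDerivAt h2
  rw [fderiv_eq_partials] at h3
  refine h3.congr_deriv (by ring)

theorem hasDerivAt_comp_graph_right {F : ℝ × ℝ × ℝ → ℝ} {u : ℝ × ℝ → ℝ} {q : ℝ × ℝ}
    (hF : DifferentiableAt ℝ F (q.1, q.2, u q)) (hu : DifferentiableAt ℝ u q) :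
    HasDerivAt (fun y => F (q.1, y, u (q.1, y)))
      (dx F (q.1, q.2, u q) + deriv (fun y => u (q.1, y)) q.2 * du F (q.1, q.2, u q)) q.2 := by
  have h1 : HasDerivAt (fun y => u (q.1, y)) (deriv (fun y => u (q.1, y)) q.2) q.2 := by
    have : DifferentiableAt ℝ (fun y => u (q.1, y)) q.2 :=
      DifferentiableAt.comp (f := fun y : ℝ => (q.1, y)) q.2 hu (by fun_prop)
    exact this.hasDerivAt
  have h2 : HasDerivAt (fun y => (q.1, y, u (q.1, y)))
      ((0, 1, deriv (fun y => u (q.1, y)) q.2) : ℝ × ℝ × ℝ) q.2 :=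
    (hasDerivAt_const q.2 q.1).prodMk ((hasDerivAt_id q.2).prodMk h1)
  have h3 := HasFDerivAt.comp_hasDerivAt (f := fun y : ℝ => (q.1, y, u (q.1, y))) q.2
    hF.hasFDerivAt h2
  rw [fderiv_eq_partials] at h3
  refine h3.congr_deriv (by ring)

end Partials

namespace Transformation

/-! ### Prolongation of the transformation to jets. -/

section Prolongation

variable {Φ : Transformation} {u v : ℝ × ℝ → ℝ} {q : ℝ × ℝ}

theorem MapsJet.eventually_left (h : Φ.MapsJet u v q) :
    ∀ᶠ s in 𝓝 q.1, v (Φ.T (s, q.2, u (s, q.2)), Φ.X (s, q.2, u (s, q.2))) =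
      Φ.U (s, q.2, u (s, q.2)) := by
  have hc : Tendsto (fun s : ℝ => (s, q.2)) (𝓝 q.1) (𝓝 q) :=
    (show Continuous fun s : ℝ => (s, q.2) by fun_prop).tendsto q.1
  exact hc.eventually h.2.2.2

theorem MapsJet.eventually_right (h : Φ.MapsJet u v q) :
    ∀ᶠ y in 𝓝 q.2, v (Φ.T (q.1, y, u (q.1, y)), Φ.X (q.1, y, u (q.1, y))) =
      Φ.U (q.1, y, u (q.1, y)) := by
  have hc : Tendsto (fun y : ℝ => (q.1, y)) (𝓝 q.2) (𝓝 q) :=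
    (show Continuous fun y : ℝ => (q.1, y) by fun_prop).tendsto q.2
  exact hc.eventually h.2.2.2

/-- The transformation of the first derivatives of `u` when `t̃` depends on `t` only. -/
theorem MapsJet.chain_rule (h : Φ.MapsJet u v q)
    (hT : DifferentiableAt ℝ Φ.T (q.1, q.2, u q)) (hX : DifferentiableAt ℝ Φ.X (q.1, q.2, u q))
    (hU : DifferentiableAt ℝ Φ.U (q.1, q.2, u q))
    (hTx : dx Φ.T (q.1, q.2, u q) = 0) (hTu : du Φ.T (q.1, q.2, u q) = 0) :
    (dt Φ.T (q.1, q.2, u q) *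
        deriv (fun s => v (s, (Φ.newIndep u q).2)) (Φ.newIndep u q).1 +
      (dt Φ.X (q.1, q.2, u q) + deriv (fun s => u (s, q.2)) q.1 * du Φ.X (q.1, q.2, u q)) *
        deriv (fun y => v ((Φ.newIndep u q).1, y)) (Φ.newIndep u q).2 =
      dt Φ.U (q.1, q.2, u q) + deriv (fun s => u (s, q.2)) q.1 * du Φ.U (q.1, q.2, u q)) ∧
    (dx Φ.X (q.1, q.2, u q) + deriv (fun y => u (q.1, y)) q.2 * du Φ.X (q.1, q.2, u q)) *
        deriv (fun y => v ((Φ.newIndep u q).1, y)) (Φ.newIndep u q).2 =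
      dx Φ.U (q.1, q.2, u q) + deriv (fun y => u (q.1, y)) q.2 * du Φ.U (q.1, q.2, u q) := by
  have hu : DifferentiableAt ℝ u q := h.1.differentiableAt (by simp)
  have hv : DifferentiableAt ℝ v (Φ.newIndep u q) := h.2.2.1.differentiableAt (by simp)
  constructor
  · have h1 := HasFDerivAt.comp_hasDerivAt
      (f := fun s => (Φ.T (s, q.2, u (s, q.2)), Φ.X (s, q.2, u (s, q.2)))) q.1 hv.hasFDerivAt
      ((hasDerivAt_comp_graph_left hT hu).prodMk (hasDerivAt_comp_graph_left hX hu))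
    have h2 := h1.congr_of_eventuallyEq
      (show (fun s => Φ.U (s, q.2, u (s, q.2))) =ᶠ[𝓝 q.1] _ from
        h.eventually_left.mono fun s hs => hs.symm)
    have h3 := h2.unique (hasDerivAt_comp_graph_left hU hu)
    rw [fderiv_prod_eq_partials hv, hTu] at h3
    rw [← h3]; ring
  · have h1 := HasFDerivAt.comp_hasDerivAt
      (f := fun y => (Φ.T (q.1, y, u (q.1, y)), Φ.X (q.1, y, u (q.1, y)))) q.2 hv.hasFDerivAt
      ((hasDerivAt_comp_graph_right hT hu).prodMk (hasDerivAt_comp_graph_right hX hu))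
    have h2 := h1.congr_of_eventuallyEq
      (show (fun y => Φ.U (q.1, y, u (q.1, y))) =ᶠ[𝓝 q.2] _ from
        h.eventually_right.mono fun s hs => hs.symm)
    have h3 := h2.unique (hasDerivAt_comp_graph_right hU hu)
    rw [fderiv_prod_eq_partials hv, hTu, hTx] at h3
    rw [← h3]; ring

/-- The prolonged transformation is defined at the jet of `u` if the total derivative of `x̃` with
respect to `x` does not vanish. -/
theorem exists_mapsJet (hu : ContDiffAt ℝ ∞ u q)
    (hT : ContDiffAt ℝ ∞ Φ.T (q.1, q.2, u q)) (hX : ContDiffAt ℝ ∞ Φ.X (q.1, q.2, u q))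
    (hU : ContDiffAt ℝ ∞ Φ.U (q.1, q.2, u q))
    (hTx : dx Φ.T (q.1, q.2, u q) = 0) (hTu : du Φ.T (q.1, q.2, u q) = 0)
    (hTt : dt Φ.T (q.1, q.2, u q) ≠ 0)
    (hξ : dx Φ.X (q.1, q.2, u q) +
      deriv (fun y => u (q.1, y)) q.2 * du Φ.X (q.1, q.2, u q) ≠ 0) :
    ∃ v, Φ.MapsJet u v q := by
  have hg : ContDiffAt ℝ ∞ (fun r : ℝ × ℝ => (r.1, r.2, u r)) q :=
    contDiffAt_fst.prodMk (contDiffAt_snd.prodMk hu)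
  have hN : ContDiffAt ℝ ∞ (Φ.newIndep u) q :=
    (ContDiffAt.comp q hT hg).prodMk (ContDiffAt.comp q hX hg)
  have hud : DifferentiableAt ℝ u q := hu.differentiableAt (by simp)
  have hNd : DifferentiableAt ℝ (Φ.newIndep u) q := hN.differentiableAt (by simp)
  have hTd : DifferentiableAt ℝ Φ.T (q.1, q.2, u q) := hT.differentiableAt (by simp)
  have hXd : DifferentiableAt ℝ Φ.X (q.1, q.2, u q) := hX.differentiableAt (by simp)
  have hcol1 : fderiv ℝ (Φ.newIndep u) q (1, 0) = (dt Φ.T (q.1, q.2, u q),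
      dt Φ.X (q.1, q.2, u q) + deriv (fun s => u (s, q.2)) q.1 * du Φ.X (q.1, q.2, u q)) := by
    have h1 : HasDerivAt (fun s => Φ.newIndep u (s, q.2)) (fderiv ℝ (Φ.newIndep u) q (1, 0)) q.1 :=
      HasFDerivAt.comp_hasDerivAt (f := fun s : ℝ => (s, q.2)) q.1 hNd.hasFDerivAt
        ((hasDerivAt_id q.1).prodMk (hasDerivAt_const q.1 q.2))
    have h2 := h1.unique
      ((hasDerivAt_comp_graph_left hTd hud).prodMk (hasDerivAt_comp_graph_left hXd hud))
    rw [h2, hTu, mul_zero, add_zero]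
  have hcol2 : fderiv ℝ (Φ.newIndep u) q (0, 1) = (0,
      dx Φ.X (q.1, q.2, u q) + deriv (fun y => u (q.1, y)) q.2 * du Φ.X (q.1, q.2, u q)) := by
    have h1 : HasDerivAt (fun y => Φ.newIndep u (q.1, y)) (fderiv ℝ (Φ.newIndep u) q (0, 1)) q.2 :=
      HasFDerivAt.comp_hasDerivAt (f := fun y : ℝ => (q.1, y)) q.2 hNd.hasFDerivAt
        ((hasDerivAt_const q.2 q.1).prodMk (hasDerivAt_id q.2))
    have h2 := h1.unique
      ((hasDerivAt_comp_graph_right hTd hud).prodMk (hasDerivAt_comp_graph_right hXd hud))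
    rw [h2, hTu, hTx, mul_zero, add_zero]
  -- Since `T_x = T_u = 0`, the total Jacobian matrix is triangular with diagonal `T_t`, `D_x X`.
  have hinj : Function.Injective (fderiv ℝ (Φ.newIndep u) q) := by
    refine (injective_iff_map_eq_zero _).2 ?_
    rintro ⟨a, b⟩ hab
    have hs : ((a, b) : ℝ × ℝ) = a • (1, 0) + b • (0, 1) := by simp
    rw [hs, map_add, map_smul, map_smul, hcol1, hcol2] at hab
    simp only [Prod.smul_mk, smul_eq_mul, mul_zero, Prod.mk_add_mk, add_zero, Prod.mk_eq_zero,
      mul_eq_zero] at hab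
    have ha : a = 0 := hab.1.resolve_right hTt
    rw [ha, zero_mul, zero_add, mul_eq_zero] at hab
    simp [ha, hab.2.resolve_right hξ]
  have hbij : Function.Bijective (fderiv ℝ (Φ.newIndep u) q) :=
    ⟨hinj, (LinearMap.injective_iff_surjective
      (f := (fderiv ℝ (Φ.newIndep u) q : ℝ × ℝ →ₗ[ℝ] ℝ × ℝ))).1 hinj⟩
  set e : (ℝ × ℝ) ≃L[ℝ] ℝ × ℝ :=
    (LinearEquiv.ofBijective (fderiv ℝ (Φ.newIndep u) q : ℝ × ℝ →ₗ[ℝ] ℝ × ℝ)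
      hbij).toContinuousLinearEquiv
  have he : HasFDerivAt (Φ.newIndep u) (e : ℝ × ℝ →L[ℝ] ℝ × ℝ) q := by
    have : (e : ℝ × ℝ →L[ℝ] ℝ × ℝ) = fderiv ℝ (Φ.newIndep u) q := by ext <;> rfl
    rw [this]; exact hNd.hasFDerivAt
  have hn : (∞ : ℕ∞ω) ≠ 0 := by simp
  -- The new function is `U` along the graph of `u`, re-expressed through the local inverse of
  -- `newIndep`.
  set ρ := hN.localInverse he hn
  have hρq : ρ (Φ.newIndep u q) = q := hN.localInverse_apply_image he hn
  have hρ : ContDiffAt ℝ ∞ ρ (Φ.newIndep u q) := hN.to_localInverse he hn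
  have hleft : ∀ᶠ r in 𝓝 q, ρ (Φ.newIndep u r) = r :=
    (hN.hasStrictFDerivAt' he hn).eventually_left_inverse
  refine ⟨fun z => Φ.U ((ρ z).1, (ρ z).2, u (ρ z)), hu, hbij, ?_, ?_⟩
  · have h1 : ContDiffAt ℝ ∞ (fun r : ℝ × ℝ => Φ.U (r.1, r.2, u r)) q := ContDiffAt.comp q hU hg
    rw [← hρq] at h1
    exact ContDiffAt.comp (f := ρ) (Φ.newIndep u q) h1 hρ
  · filter_upwards [hleft] with r hr
    simp only [hr]

end Prolongation

end Transformation

/-! ### Test functions and test equations. -/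

section TestFunctions

/-- A polynomial with prescribed derivatives at `z`. -/
def testFun (z : ℝ × ℝ) (s c₀ c₁ c₃ c₄ c₅ : ℝ) (q : ℝ × ℝ) : ℝ :=
  s * (q.1 - z.1) + (c₀ + c₁ * (q.2 - z.2) + 0 * (q.2 - z.2) ^ 2 + c₃ * (q.2 - z.2) ^ 3 +
    c₄ * (q.2 - z.2) ^ 4 + c₅ * (q.2 - z.2) ^ 5)

variable (z : ℝ × ℝ) (s c₀ c₁ c₃ c₄ c₅ : ℝ)

theorem contDiff_testFun : ContDiff ℝ ∞ (testFun z s c₀ c₁ c₃ c₄ c₅) := by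
  unfold testFun; fun_prop

@[simp]
theorem testFun_self : testFun z s c₀ c₁ c₃ c₄ c₅ z = c₀ := by simp [testFun]

theorem testFun_slice (y : ℝ) : testFun z s c₀ c₁ c₃ c₄ c₅ (z.1, y) =
    c₀ + c₁ * (y - z.2) + 0 * (y - z.2) ^ 2 + c₃ * (y - z.2) ^ 3 +
    c₄ * (y - z.2) ^ 4 + c₅ * (y - z.2) ^ 5 := by simp [testFun]

@[simp]
theorem deriv_testFun_left : deriv (fun r => testFun z s c₀ c₁ c₃ c₄ c₅ (r, z.2)) z.1 = s := by
  have : (fun r => testFun z s c₀ c₁ c₃ c₄ c₅ (r, z.2)) = fun r => s * (r - z.1) + c₀ := by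
    funext r; simp [testFun]
  rw [this]
  have h : HasDerivAt (fun r => s * (r - z.1) + c₀) (s * 1) z.1 :=
    (((hasDerivAt_id z.1).sub_const z.1).const_mul s).add_const c₀
  rw [h.deriv, mul_one]

@[simp]
theorem deriv_testFun_right : deriv (fun y => testFun z s c₀ c₁ c₃ c₄ c₅ (z.1, y)) z.2 = c₁ := by
  simp only [testFun_slice]
  exact (iteratedDeriv_quintic c₀ c₁ c₃ c₄ c₅ z.2).1

theorem lhs_testFun (E : Equation) : E.lhs (testFun z s c₀ c₁ c₃ c₄ c₅) z =
    s + c₀ * c₁ + E.β z.1 * (6 * c₃) + E.σ z.1 * (120 * c₅) := by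
  obtain ⟨-, h3, h5⟩ := iteratedDeriv_quintic c₀ c₁ c₃ c₄ c₅ z.2
  rw [Equation.lhs, deriv_testFun_left, deriv_testFun_right, testFun_self]
  simp only [testFun_slice]
  rw [h3, h5]

end TestFunctions

/-- The equation with exponential coefficients that take the values `β₀` and `σ₀` at `t₀`. -/
noncomputable def expEquation (t₀ β₀ σ₀ m n : ℝ) (hβ : β₀ ≠ 0) (hσ : σ₀ ≠ 0) : Equation where
  I := Set.univ
  β := fun t => β₀ * Real.exp (m * (t - t₀))
  σ := fun t => σ₀ * Real.exp (n * (t - t₀))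
  isOpen_I := isOpen_univ
  ordConnected_I := Set.ordConnected_univ
  nonempty_I := Set.univ_nonempty
  smooth_β := ContDiff.contDiffOn (by fun_prop)
  smooth_σ := ContDiff.contDiffOn (by fun_prop)
  β_ne_zero := fun _ _ => mul_ne_zero hβ (Real.exp_ne_zero _)
  σ_ne_zero := fun _ _ => mul_ne_zero hσ (Real.exp_ne_zero _)

/-! ### Nondegeneracy, and dependence of the new time on the old time only. -/

namespace Transformation

variable {Φ : Transformation} {Ω : Set (ℝ × ℝ × ℝ)}

theorem isOpen_extendedDomain (hΩ : IsOpen Ω) : IsOpen (extendedDomain Ω) :=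
  (hΩ.preimage continuous_fst).inter
    ((isOpen_ne_fun (by fun_prop) continuous_const).inter
      (isOpen_ne_fun (by fun_prop) continuous_const))

section Smoothness

theorem IsNondegenerate.contDiffAt_toMap (h : Φ.IsNondegenerate Ω) (hΩ : IsOpen Ω)
    {q : (ℝ × ℝ × ℝ) × ℝ × ℝ} (hq : q ∈ extendedDomain Ω) : ContDiffAt ℝ ∞ Φ.toMap q :=
  h.1.contDiffAt ((isOpen_extendedDomain hΩ).mem_nhds hq)

theorem IsNondegenerate.contDiffAt_variables (h : Φ.IsNondegenerate Ω) (hΩ : IsOpen Ω)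
    {p : ℝ × ℝ × ℝ} (hp : p ∈ Ω) : ContDiffAt ℝ ∞ (fun p => (Φ.T p, Φ.X p, Φ.U p)) p := by
  have h1 := h.contDiffAt_toMap hΩ (q := (p, 1, 1)) ⟨hp, one_ne_zero, one_ne_zero⟩
  have h2 : ContDiffAt ℝ ∞ (fun p : ℝ × ℝ × ℝ => (Φ.toMap (p, 1, 1)).1) p :=
    contDiffAt_fst.comp p (ContDiffAt.comp p h1 (contDiffAt_id.prodMk contDiffAt_const))
  exact h2

theorem IsNondegenerate.contDiffAt_T (h : Φ.IsNondegenerate Ω) (hΩ : IsOpen Ω)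
    {p : ℝ × ℝ × ℝ} (hp : p ∈ Ω) : ContDiffAt ℝ ∞ Φ.T p :=
  contDiffAt_fst.comp p (h.contDiffAt_variables hΩ hp)

theorem IsNondegenerate.contDiffAt_X (h : Φ.IsNondegenerate Ω) (hΩ : IsOpen Ω)
    {p : ℝ × ℝ × ℝ} (hp : p ∈ Ω) : ContDiffAt ℝ ∞ Φ.X p :=
  contDiffAt_fst.comp p (contDiffAt_snd.comp p (h.contDiffAt_variables hΩ hp))

theorem IsNondegenerate.contDiffAt_U (h : Φ.IsNondegenerate Ω) (hΩ : IsOpen Ω)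
    {p : ℝ × ℝ × ℝ} (hp : p ∈ Ω) : ContDiffAt ℝ ∞ Φ.U p :=
  contDiffAt_snd.comp p (contDiffAt_snd.comp p (h.contDiffAt_variables hΩ hp))

theorem IsNondegenerate.contDiffAt_B (h : Φ.IsNondegenerate Ω) (hΩ : IsOpen Ω)
    {q : (ℝ × ℝ × ℝ) × ℝ × ℝ} (hq : q ∈ extendedDomain Ω) : ContDiffAt ℝ ∞ Φ.B q :=
  contDiffAt_fst.comp q (contDiffAt_snd.comp q (h.contDiffAt_toMap hΩ hq))

theorem IsNondegenerate.contDiffAt_S (h : Φ.IsNondegenerate Ω) (hΩ : IsOpen Ω)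
    {q : (ℝ × ℝ × ℝ) × ℝ × ℝ} (hq : q ∈ extendedDomain Ω) : ContDiffAt ℝ ∞ Φ.S q :=
  contDiffAt_snd.comp q (contDiffAt_snd.comp q (h.contDiffAt_toMap hΩ hq))

theorem hasFDerivAt_toMap {q : (ℝ × ℝ × ℝ) × ℝ × ℝ} (hT : DifferentiableAt ℝ Φ.T q.1)
    (hX : DifferentiableAt ℝ Φ.X q.1) (hU : DifferentiableAt ℝ Φ.U q.1)
    (hB : DifferentiableAt ℝ Φ.B q) (hS : DifferentiableAt ℝ Φ.S q) :
    HasFDerivAt Φ.toMap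
      (((((fderiv ℝ Φ.T q.1).prod ((fderiv ℝ Φ.X q.1).prod (fderiv ℝ Φ.U q.1))).comp
        (ContinuousLinearMap.fst ℝ (ℝ × ℝ × ℝ) (ℝ × ℝ))).prod
        ((fderiv ℝ Φ.B q).prod (fderiv ℝ Φ.S q)))) q := by
  have h1 : HasFDerivAt (fun p => (Φ.T p, Φ.X p, Φ.U p))
      ((fderiv ℝ Φ.T q.1).prod ((fderiv ℝ Φ.X q.1).prod (fderiv ℝ Φ.U q.1))) q.1 :=
    hT.hasFDerivAt.prodMk (hX.hasFDerivAt.prodMk hU.hasFDerivAt)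
  exact (HasFDerivAt.comp q h1 hasFDerivAt_fst).prodMk (hB.hasFDerivAt.prodMk hS.hasFDerivAt)

theorem IsNondegenerate.fderiv_toMap_apply (h : Φ.IsNondegenerate Ω) (hΩ : IsOpen Ω)
    {q : (ℝ × ℝ × ℝ) × ℝ × ℝ} (hq : q ∈ extendedDomain Ω) (w : (ℝ × ℝ × ℝ) × ℝ × ℝ) :
    fderiv ℝ Φ.toMap q w =
      ((fderiv ℝ Φ.T q.1 w.1, fderiv ℝ Φ.X q.1 w.1, fderiv ℝ Φ.U q.1 w.1),
        fderiv ℝ Φ.B q w, fderiv ℝ Φ.S q w) := by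
  rw [(hasFDerivAt_toMap ((h.contDiffAt_T hΩ hq.1).differentiableAt (by simp))
    ((h.contDiffAt_X hΩ hq.1).differentiableAt (by simp))
    ((h.contDiffAt_U hΩ hq.1).differentiableAt (by simp))
    ((h.contDiffAt_B hΩ hq).differentiableAt (by simp))
    ((h.contDiffAt_S hΩ hq).differentiableAt (by simp))).fderiv]
  rfl

end Smoothness

section Projectibility

theorem MapsEquation.eventually_coeff {E E' : Equation} (h : Φ.MapsEquation Ω E E')
    (hΩ : IsOpen Ω) {p : ℝ × ℝ × ℝ} (hp : p ∈ Ω) (hpE : p.1 ∈ E.I) :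
    ∀ᶠ p' in 𝓝 p, E'.β (Φ.T p') = Φ.B (p', E.β p'.1, E.σ p'.1) ∧
      E'.σ (Φ.T p') = Φ.S (p', E.β p'.1, E.σ p'.1) := by
  have h1 : ∀ᶠ p' : ℝ × ℝ × ℝ in 𝓝 p, p'.1 ∈ E.I :=
    continuous_fst.continuousAt.eventually (E.isOpen_I.mem_nhds hpE)
  filter_upwards [hΩ.mem_nhds hp, h1] with p' hp' hE
  exact (h.1 p' hp' hE).2

/-- A function of `(t, x, u, β, σ)` that, for all exponential coefficients, becomes a function of
`τ` alone, where `τ` has a nonzero derivative along the fibre, does not depend on `β` and `σ`. -/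
theorem fderiv_coeff_eq_zero {G : (ℝ × ℝ × ℝ) × ℝ × ℝ → ℝ} {τ : ℝ × ℝ × ℝ → ℝ} {p : ℝ × ℝ × ℝ}
    {w : ℝ × ℝ × ℝ} (hG : DifferentiableAt ℝ G (p, 1, 1)) (hτ : DifferentiableAt ℝ τ p)
    (hw : w.1 = 0) (hτw : fderiv ℝ τ p w ≠ 0)
    (h : ∀ m n : ℝ, ∃ b : ℝ → ℝ, DifferentiableAt ℝ b (τ p) ∧ ∀ᶠ p' in 𝓝 p,
      b (τ p') = G (p', 1 * Real.exp (m * (p'.1 - p.1)), 1 * Real.exp (n * (p'.1 - p.1))))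
    (m n : ℝ) : fderiv ℝ G (p, 1, 1) (0, m, n) = 0 := by
  -- Chain rule for `b ∘ τ`: on the section with slopes `m`, `n` the differential of `G` is a
  -- multiple of that of `τ`.
  have key : ∀ m n : ℝ, ∃ l : ℝ, ∀ z : ℝ × ℝ × ℝ,
      fderiv ℝ G (p, 1, 1) (z, m * z.1, n * z.1) = l * fderiv ℝ τ p z := by
    intro m n
    obtain ⟨b, hb, hbG⟩ := h m n
    refine ⟨deriv b (τ p), fun z => ?_⟩
    have h1 : ∀ k : ℝ, HasFDerivAt (fun p' : ℝ × ℝ × ℝ => 1 * Real.exp (k * (p'.1 - p.1)))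
        (k • ContinuousLinearMap.fst ℝ ℝ (ℝ × ℝ)) p := by
      intro k
      have h2 : HasFDerivAt (fun p' : ℝ × ℝ × ℝ => k * (p'.1 - p.1))
          (k • ContinuousLinearMap.fst ℝ ℝ (ℝ × ℝ)) p := by
        have h0 : HasFDerivAt (fun p' : ℝ × ℝ × ℝ => p'.1)
          (ContinuousLinearMap.fst ℝ ℝ (ℝ × ℝ)) p := hasFDerivAt_fst
        exact (h0.sub_const p.1).const_mul k
      have h3 := h2.exp.const_mul 1
      simpa using h3
    have hG' : HasFDerivAt G (fderiv ℝ G (p, 1, 1))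
        (p, 1 * Real.exp (m * (p.1 - p.1)), 1 * Real.exp (n * (p.1 - p.1))) := by
      simpa using hG.hasFDerivAt
    have h4 := HasFDerivAt.comp (f := fun p' : ℝ × ℝ × ℝ =>
      (p', 1 * Real.exp (m * (p'.1 - p.1)), 1 * Real.exp (n * (p'.1 - p.1)))) p hG'
      ((hasFDerivAt_id p).prodMk ((h1 m).prodMk (h1 n)))
    have h5 := h4.congr_of_eventuallyEq (show (fun p' => b (τ p')) =ᶠ[𝓝 p] _ from hbG)
    have h6 : HasFDerivAt (fun p' => b (τ p')) (deriv b (τ p) • fderiv ℝ τ p) p :=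
      hb.hasDerivAt.comp_hasFDerivAt p hτ.hasFDerivAt
    have h7 := congrArg (fun L => L z) (h5.unique h6)
    simpa using h7
  obtain ⟨l, hl⟩ := key m n
  obtain ⟨l', hl'⟩ := key 0 0
  -- Along `w`, which has no `t`-component, the slopes are invisible. So the multiplier is the same
  -- for slopes `(m, n)` and `(0, 0)`, and subtracting the two identities in the direction of `t`
  -- isolates `(0, m, n)`.
  have h1 : l * fderiv ℝ τ p w = l' * fderiv ℝ τ p w := by
    rw [← hl, ← hl', hw, mul_zero, mul_zero, mul_zero]
  have h2 : l = l' := mul_right_cancel₀ hτw h1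
  have h3 := hl (1, 0, 0)
  have h4 := hl' (1, 0, 0)
  rw [h2, ← h4] at h3
  have h5 : ((0, m, n) : (ℝ × ℝ × ℝ) × ℝ × ℝ) = ((1, 0, 0), m * 1, n * 1) -
      ((1, 0, 0), 0 * 1, 0 * 1) := by simp
  rw [h5, map_sub]
  exact sub_eq_zero.2 h3

/-- If `T` varied in a direction transversal to `t`, then `B` and `S` would have zero derivative in
the direction of `β`. As `T`, `X`, `U` do not involve `β` either, the differential of the whole
transformation would have a kernel. -/
theorem IsUsualEquivalence.fderiv_T_eq_zero (h : Φ.IsUsualEquivalence Ω) (hΩ : IsOpen Ω)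
    {p : ℝ × ℝ × ℝ} (hp : p ∈ Ω) {w : ℝ × ℝ × ℝ} (hw : w.1 = 0) : fderiv ℝ Φ.T p w = 0 := by
  by_contra hne
  have hq : ((p, 1, 1) : (ℝ × ℝ × ℝ) × ℝ × ℝ) ∈ extendedDomain Ω := ⟨hp, one_ne_zero, one_ne_zero⟩
  have hTd : DifferentiableAt ℝ Φ.T p := (h.1.contDiffAt_T hΩ hp).differentiableAt (by simp)
  have hB := fderiv_coeff_eq_zero ((h.1.contDiffAt_B hΩ hq).differentiableAt (by simp)) hTd hw hne
    (fun m n => by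
      obtain ⟨E', hE'⟩ := h.2 (expEquation p.1 1 1 m n one_ne_zero one_ne_zero)
      refine ⟨E'.β, ?_, (hE'.eventually_coeff hΩ hp (Set.mem_univ _)).mono fun p' hp' => hp'.1⟩
      exact (E'.smooth_β.contDiffAt (E'.isOpen_I.mem_nhds
        (hE'.1 p hp (Set.mem_univ _)).1)).differentiableAt (by simp)) 1 0
  have hS := fderiv_coeff_eq_zero ((h.1.contDiffAt_S hΩ hq).differentiableAt (by simp)) hTd hw hne
    (fun m n => by
      obtain ⟨E', hE'⟩ := h.2 (expEquation p.1 1 1 m n one_ne_zero one_ne_zero)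
      refine ⟨E'.σ, ?_, (hE'.eventually_coeff hΩ hp (Set.mem_univ _)).mono fun p' hp' => hp'.2⟩
      exact (E'.smooth_σ.contDiffAt (E'.isOpen_I.mem_nhds
        (hE'.1 p hp (Set.mem_univ _)).1)).differentiableAt (by simp)) 1 0
  have h0 : fderiv ℝ Φ.toMap (p, 1, 1) (0, 1, 0) = 0 := by
    rw [h.1.fderiv_toMap_apply hΩ hq, hB, hS]
    simp
  have h1 := (h.1.2 _ hq).1 (h0.trans (map_zero _).symm)
  simp at h1

theorem IsUsualEquivalence.dx_T (h : Φ.IsUsualEquivalence Ω) (hΩ : IsOpen Ω)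
    {p : ℝ × ℝ × ℝ} (hp : p ∈ Ω) : dx Φ.T p = 0 := h.fderiv_T_eq_zero hΩ hp rfl

theorem IsUsualEquivalence.du_T (h : Φ.IsUsualEquivalence Ω) (hΩ : IsOpen Ω)
    {p : ℝ × ℝ × ℝ} (hp : p ∈ Ω) : du Φ.T p = 0 := h.fderiv_T_eq_zero hΩ hp rfl

/-- The variable components ignore `β` and `σ`, so surjectivity of the full differential passes to
them, and injectivity follows by dimension. -/
theorem IsNondegenerate.bijective_variables (h : Φ.IsNondegenerate Ω) (hΩ : IsOpen Ω)
    {p : ℝ × ℝ × ℝ} (hp : p ∈ Ω) : Function.Bijective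
      ((fderiv ℝ Φ.T p).prod ((fderiv ℝ Φ.X p).prod (fderiv ℝ Φ.U p))) := by
  have hq : ((p, 1, 1) : (ℝ × ℝ × ℝ) × ℝ × ℝ) ∈ extendedDomain Ω := ⟨hp, one_ne_zero, one_ne_zero⟩
  have hs : Function.Surjective
      ((fderiv ℝ Φ.T p).prod ((fderiv ℝ Φ.X p).prod (fderiv ℝ Φ.U p))) := by
    intro z
    obtain ⟨w, hw⟩ := (h.2 _ hq).2 (z, 0)
    rw [h.fderiv_toMap_apply hΩ hq] at hw
    exact ⟨w.1, congrArg Prod.fst hw⟩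
  exact ⟨(LinearMap.injective_iff_surjective (f := (((fderiv ℝ Φ.T p).prod
    ((fderiv ℝ Φ.X p).prod (fderiv ℝ Φ.U p)) : ℝ × ℝ × ℝ →ₗ[ℝ] ℝ × ℝ × ℝ)))).2 hs, hs⟩

theorem IsUsualEquivalence.dt_T_ne_zero (h : Φ.IsUsualEquivalence Ω) (hΩ : IsOpen Ω)
    {p : ℝ × ℝ × ℝ} (hp : p ∈ Ω) : dt Φ.T p ≠ 0 := by
  intro h0
  obtain ⟨⟨a, b, c⟩, hw⟩ := (h.1.bijective_variables hΩ hp).2 (1, 0, 0)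
  have h1 : fderiv ℝ Φ.T p (a, b, c) = 1 := congrArg Prod.fst hw
  rw [fderiv_eq_partials, h0, h.dx_T hΩ hp, h.du_T hΩ hp] at h1
  simp at h1

theorem IsUsualEquivalence.jacobian_ne_zero (h : Φ.IsUsualEquivalence Ω) (hΩ : IsOpen Ω)
    {p : ℝ × ℝ × ℝ} (hp : p ∈ Ω) : dx Φ.X p * du Φ.U p - du Φ.X p * dx Φ.U p ≠ 0 := by
  intro h0
  have key : ∀ b c : ℝ, b * dx Φ.X p + c * du Φ.X p = 0 → b * dx Φ.U p + c * du Φ.U p = 0 →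
      b = 0 ∧ c = 0 := by
    intro b c h1 h2
    have h3 : (fderiv ℝ Φ.T p).prod ((fderiv ℝ Φ.X p).prod (fderiv ℝ Φ.U p)) (0, b, c) = 0 := by
      simp only [ContinuousLinearMap.prod_apply, fderiv_eq_partials, h.dx_T hΩ hp, h.du_T hΩ hp]
      simp [h1, h2]
    have h4 := (h.1.bijective_variables hΩ hp).1 (h3.trans (map_zero _).symm)
    simpa using h4
  -- If the determinant vanished, these cofactor vectors would lie in the kernel; they must then be
  -- zero, which makes the whole matrix zero.
  have h1 := key (-du Φ.X p) (dx Φ.X p) (by ring) (by linarith)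
  have h2 := key (-du Φ.U p) (dx Φ.U p) (by linarith) (by ring)
  have h3 := key 1 0 (by simp [h1.2]) (by simp [h2.2])
  exact one_ne_zero h3.1

end Projectibility

end Transformation

/-! ### Mixed partials and expansions along the fibres over `t`. -/

section Partials

variable {F : ℝ × ℝ × ℝ → ℝ} {p : ℝ × ℝ × ℝ}

theorem contDiffAt_fderiv_apply (hF : ContDiffAt ℝ ∞ F p) (a : ℝ × ℝ × ℝ) :
    ContDiffAt ℝ ∞ (fun p' => fderiv ℝ F p' a) p :=
  (hF.fderiv_right (m := ∞) (by simp)).clm_apply contDiffAt_const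

theorem contDiffAt_dt (hF : ContDiffAt ℝ ∞ F p) : ContDiffAt ℝ ∞ (dt F) p :=
  contDiffAt_fderiv_apply hF _

theorem contDiffAt_dx (hF : ContDiffAt ℝ ∞ F p) : ContDiffAt ℝ ∞ (dx F) p :=
  contDiffAt_fderiv_apply hF _

theorem contDiffAt_du (hF : ContDiffAt ℝ ∞ F p) : ContDiffAt ℝ ∞ (du F) p :=
  contDiffAt_fderiv_apply hF _

theorem fderiv_fderiv_comm (hF : ContDiffAt ℝ ∞ F p) (a b : ℝ × ℝ × ℝ) :
    fderiv ℝ (fun p' => fderiv ℝ F p' a) p b = fderiv ℝ (fun p' => fderiv ℝ F p' b) p a := by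
  have hd : DifferentiableAt ℝ (fderiv ℝ F) p :=
    (hF.fderiv_right (m := ∞) (by simp)).differentiableAt (by simp)
  have h : ∀ c : ℝ × ℝ × ℝ, fderiv ℝ (fun p' => fderiv ℝ F p' c) p =
      (fderiv ℝ (fderiv ℝ F) p).flip c := fun c => by
    have := (hd.hasFDerivAt.clm_apply (hasFDerivAt_const c p)).fderiv
    rw [this]; ext <;> simp
  rw [h, h]
  have h2 : minSmoothness ℝ 2 ≤ (∞ : ℕ∞ω) := by
    rw [minSmoothness_of_isRCLikeNormedField]
    exact WithTop.coe_le_coe.2 (le_top : (2 : ℕ∞) ≤ ⊤)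
  exact (hF.isSymmSndFDerivAt h2).eq b a

theorem dx_dt (hF : ContDiffAt ℝ ∞ F p) : dx (dt F) p = dt (dx F) p :=
  fderiv_fderiv_comm hF _ _

theorem du_dt (hF : ContDiffAt ℝ ∞ F p) : du (dt F) p = dt (du F) p :=
  fderiv_fderiv_comm hF _ _

theorem du_dx (hF : ContDiffAt ℝ ∞ F p) : du (dx F) p = dx (du F) p :=
  fderiv_fderiv_comm hF _ _

theorem hasFDerivAt_slice (hF : DifferentiableAt ℝ F p) :
    HasFDerivAt (fun z : ℝ × ℝ => F (p.1, z))
      ((fderiv ℝ F p).comp (ContinuousLinearMap.inr ℝ ℝ (ℝ × ℝ))) p.2 := by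
  have h := HasFDerivAt.comp (f := fun z : ℝ × ℝ => (p.1, z)) p.2 (g := F) hF.hasFDerivAt
    (hasFDerivAt_prodMk_right p.1 p.2)
  exact h

theorem eventually_slice_mem {Ω : Set (ℝ × ℝ × ℝ)} (hΩ : IsOpen Ω) (hp : p ∈ Ω) :
    ∀ᶠ z in 𝓝 p.2, (p.1, z) ∈ Ω :=
  (show Continuous fun z : ℝ × ℝ => (p.1, z) by fun_prop).continuousAt.eventually
    (hΩ.mem_nhds hp)

/-- A function with constant derivative along the fibre over `t` is affine on it. -/
theorem eventually_slice_eq_affine {a b : ℝ}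
    (h : ∀ᶠ z in 𝓝 p.2, DifferentiableAt ℝ F (p.1, z) ∧ dx F (p.1, z) = a ∧ du F (p.1, z) = b) :
    ∀ᶠ z in 𝓝 p.2, F (p.1, z) = F p + a * (z.1 - p.2.1) + b * (z.2 - p.2.2) := by
  obtain ⟨r, hr, hb⟩ := Metric.eventually_nhds_iff_ball.1 h
  refine Metric.eventually_nhds_iff_ball.2 ⟨r, hr, fun z hz => ?_⟩
  have hd : ∀ z ∈ Metric.ball p.2 r,
      HasFDerivAt (fun z : ℝ × ℝ => F (p.1, z) - a * z.1 - b * z.2)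
        (0 : ℝ × ℝ →L[ℝ] ℝ) z := by
    intro z hz
    obtain ⟨h1, h2, h3⟩ := hb z hz
    have h4 := ((hasFDerivAt_slice (p := (p.1, z)) h1).sub
      ((hasFDerivAt_fst (𝕜 := ℝ) (p := z)).const_mul a)).sub
      ((hasFDerivAt_snd (𝕜 := ℝ) (p := z)).const_mul b)
    refine h4.congr_fderiv ?_
    ext
    · simpa [dx, sub_eq_zero] using h2
    · simpa [du, sub_eq_zero] using h3
  have hc := (convex_ball p.2 r).is_const_of_fderivWithin_eq_zero (𝕜 := ℝ)
    (fun z hz => (hd z hz).differentiableAt.differentiableWithinAt)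
    (fun z hz => by
      rw [fderivWithin_of_isOpen Metric.isOpen_ball hz, (hd z hz).fderiv]) hz
      (Metric.mem_ball_self hr)
  linarith

/-- A function whose `u`-derivative is constant along the fibre over `t` is affine in `u`. -/
theorem eventually_slice_eq_affine_right {b : ℝ}
    (h : ∀ᶠ z in 𝓝 p.2, DifferentiableAt ℝ F (p.1, z) ∧ du F (p.1, z) = b) :
    ∀ᶠ z in 𝓝 p.2, F (p.1, z) = b * z.2 + (F (p.1, z.1, p.2.2) - b * p.2.2) := by
  obtain ⟨r, hr, hb⟩ := Metric.eventually_nhds_iff_ball.1 h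
  refine Metric.eventually_nhds_iff_ball.2 ⟨r, hr, fun z hz => ?_⟩
  have hz1 : z.1 ∈ Metric.ball p.2.1 r ∧ z.2 ∈ Metric.ball p.2.2 r := by
    rwa [← Set.mem_prod, ball_prod_same]
  have hd : ∀ s ∈ Metric.ball p.2.2 r, HasDerivAt (fun s => F (p.1, z.1, s) - b * s) 0 s := by
    intro s hs
    have hm : (z.1, s) ∈ Metric.ball p.2 r := by
      rw [← ball_prod_same]
      exact ⟨hz1.1, hs⟩
    obtain ⟨h1, h2⟩ := hb _ hm
    have h3 := HasFDerivAt.comp_hasDerivAt (f := fun s : ℝ => (p.1, z.1, s)) s h1.hasFDerivAt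
      ((hasDerivAt_const s p.1).prodMk ((hasDerivAt_const s z.1).prodMk (hasDerivAt_id s)))
    have h4 := h3.sub ((hasDerivAt_id s).const_mul b)
    refine h4.congr_deriv ?_
    have : fderiv ℝ F (p.1, z.1, s) (0, 0, 1) = b := h2
    rw [this]; ring
  have hc := (convex_ball p.2.2 r).is_const_of_fderivWithin_eq_zero (𝕜 := ℝ)
    (fun s hs => (hd s hs).differentiableAt.differentiableWithinAt)
    (fun s hs => by
      rw [fderivWithin_of_isOpen Metric.isOpen_ball hs, (hd s hs).hasFDerivAt.fderiv]
      simp) hz1.2 (Metric.mem_ball_self hr)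
  have : F (p.1, z) = F (p.1, z.1, z.2) := rfl
  rw [this]; linarith

/-- Strict differentiability compares the values of `F` at two moving points; these differ in the
`u`-coordinate only, so only `F_u` appears. -/
theorem isLittleO_sub_along {u₀ u₁ : ℝ → ℝ} (hF : ContDiffAt ℝ ∞ F p)
    (h₀ : Tendsto u₀ (𝓝 p.2.1) (𝓝 p.2.2)) (h₁ : Tendsto u₁ (𝓝 p.2.1) (𝓝 p.2.2)) :
    (fun y => F (p.1, y, u₁ y) - F (p.1, y, u₀ y) - du F p * (u₁ y - u₀ y)) =o[𝓝 p.2.1]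
      fun y => u₁ y - u₀ y := by
  have hs : HasStrictFDerivAt F (fderiv ℝ F p) p := hF.hasStrictFDerivAt (by simp)
  have ht : ∀ {u : ℝ → ℝ}, Tendsto u (𝓝 p.2.1) (𝓝 p.2.2) →
      Tendsto (fun y => (p.1, y, u y)) (𝓝 p.2.1) (𝓝 p) := fun hu =>
    tendsto_const_nhds.prodMk_nhds (tendsto_id.prodMk_nhds hu)
  have h := hs.isLittleO.comp_tendsto ((ht h₁).prodMk_nhds (ht h₀))
  have h2 : (fun y => F (p.1, y, u₁ y) - F (p.1, y, u₀ y) - du F p * (u₁ y - u₀ y)) =o[𝓝 p.2.1]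
      fun y => (((0 : ℝ), (0 : ℝ), u₁ y - u₀ y) : ℝ × ℝ × ℝ) := by
    refine h.congr (fun y => ?_) (fun y => by simp)
    simp only [Function.comp, Prod.mk_sub_mk, sub_self, fderiv_eq_partials]
    ring
  refine h2.trans_isBigO (IsBigO.of_bound 1 (Eventually.of_forall fun y => ?_))
  simp [Prod.norm_def]

/-- The effect of a fourth-order perturbation of a curve up to fifth order. -/
theorem isLittleO_sub_along_quartic (hF : ContDiffAt ℝ ∞ F p) (c : ℝ) :
    (fun y => F (p.1, y, p.2.2 + c * (y - p.2.1) + (y - p.2.1) ^ 4) -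
        F (p.1, y, p.2.2 + c * (y - p.2.1)) -
        (du F p * (y - p.2.1) ^ 4 + (dx (du F) p + c * du (du F) p) * (y - p.2.1) ^ 5))
      =o[𝓝 p.2.1] fun y => (y - p.2.1) ^ 5 := by
  have hev : ∀ᶠ p' in 𝓝 p, DifferentiableAt ℝ F p' := by
    have := (hF.of_le (m := 1) (by simp)).eventually (by simp)
    exact this.mono fun p' hp' => hp'.differentiableAt (by simp)
  obtain ⟨r, hr, hball⟩ := Metric.eventually_nhds_iff_ball.1 hev
  -- Mean value theorem in `u`. The membership conditions sit inside the existential so that `s` can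
  -- be chosen for every `y`; off the ball its value is immaterial.
  have hmv : ∀ y : ℝ, ∃ s ∈ Set.Icc (0 : ℝ) 1,
      ((p.1, y, p.2.2 + c * (y - p.2.1) + (y - p.2.1) ^ 4) ∈ Metric.ball p r →
        (p.1, y, p.2.2 + c * (y - p.2.1)) ∈ Metric.ball p r →
      F (p.1, y, p.2.2 + c * (y - p.2.1) + (y - p.2.1) ^ 4) -
        F (p.1, y, p.2.2 + c * (y - p.2.1)) =
        du F (p.1, y, p.2.2 + c * (y - p.2.1) + s * (y - p.2.1) ^ 4) * (y - p.2.1) ^ 4) := by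
    intro y
    by_cases hm : (p.1, y, p.2.2 + c * (y - p.2.1) + (y - p.2.1) ^ 4) ∈ Metric.ball p r ∧
        (p.1, y, p.2.2 + c * (y - p.2.1)) ∈ Metric.ball p r
    swap
    · exact ⟨0, by simp, fun h1 h2 => absurd ⟨h1, h2⟩ hm⟩
    have hd : ∀ s ∈ Set.Icc (0 : ℝ) 1, HasDerivAt
        (fun s => F (p.1, y, p.2.2 + c * (y - p.2.1) + s * (y - p.2.1) ^ 4))
        (du F (p.1, y, p.2.2 + c * (y - p.2.1) + s * (y - p.2.1) ^ 4) * (y - p.2.1) ^ 4) s := by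
      intro s hs
      have hmem : (p.1, y, p.2.2 + c * (y - p.2.1) + s * (y - p.2.1) ^ 4) ∈ Metric.ball p r := by
        have h := convex_ball p r hm.2 hm.1 (sub_nonneg.2 hs.2) hs.1 (by ring)
        convert h using 1
        ext <;> simp <;> ring
      have h1 := HasFDerivAt.comp_hasDerivAt
        (f := fun s : ℝ => (p.1, y, p.2.2 + c * (y - p.2.1) + s * (y - p.2.1) ^ 4)) s
        (hball _ hmem).hasFDerivAt
        ((hasDerivAt_const s p.1).prodMk ((hasDerivAt_const s y).prodMk
          (((hasDerivAt_id s).mul_const ((y - p.2.1) ^ 4)).const_add (p.2.2 + c * (y - p.2.1)))))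
      rw [fderiv_eq_partials] at h1
      exact h1.congr_deriv (by ring)
    obtain ⟨s, hs, hsl⟩ := exists_hasDerivAt_eq_slope _ _ (zero_lt_one' ℝ)
      (fun s hs => (hd s hs).continuousAt.continuousWithinAt)
      (fun s hs => hd s (Set.Ioo_subset_Icc_self hs))
    refine ⟨s, Set.Ioo_subset_Icc_self hs, fun _ _ => ?_⟩
    simp only [one_mul, zero_mul, add_zero, sub_zero, div_one] at hsl
    exact hsl.symm
  choose s hs hsF using hmv
  have ht1 : Tendsto (fun y => (p.1, y, p.2.2 + c * (y - p.2.1) + (y - p.2.1) ^ 4)) (𝓝 p.2.1)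
      (𝓝 p) := by
    have h : Continuous fun y : ℝ => (p.1, y, p.2.2 + c * (y - p.2.1) + (y - p.2.1) ^ 4) := by
      fun_prop
    simpa using h.tendsto p.2.1
  have ht0 : Tendsto (fun y => (p.1, y, p.2.2 + c * (y - p.2.1))) (𝓝 p.2.1) (𝓝 p) := by
    have h : Continuous fun y : ℝ => (p.1, y, p.2.2 + c * (y - p.2.1)) := by fun_prop
    simpa using h.tendsto p.2.1
  have hsO : (fun y => s y * (y - p.2.1) ^ 4) =O[𝓝 p.2.1] fun y => (y - p.2.1) ^ 4 := by
    refine IsBigO.of_bound 1 (Eventually.of_forall fun y => ?_)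
    rw [norm_mul]
    gcongr
    rw [Real.norm_eq_abs, abs_of_nonneg (hs y).1]
    exact (hs y).2
  have h41 : (fun y : ℝ => (y - p.2.1) ^ 4) =o[𝓝 p.2.1] fun y => y - p.2.1 := by
    have := isLittleO_pow_sub_sub p.2.1 (m := 4) (by norm_num)
    exact (this.norm_left.congr_left fun y => by simp).of_norm_left
  have hs1 : (fun y => s y * (y - p.2.1) ^ 4) =o[𝓝 p.2.1] fun y => y - p.2.1 :=
    hsO.trans_isLittleO h41
  have htz : Tendsto (fun y => y - p.2.1) (𝓝 p.2.1) (𝓝 0) := by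
    have h : Continuous fun y : ℝ => y - p.2.1 := by fun_prop
    simpa using h.tendsto p.2.1
  have hts : Tendsto (fun y => (p.1, y, p.2.2 + c * (y - p.2.1) + s y * (y - p.2.1) ^ 4))
      (𝓝 p.2.1) (𝓝 p) := by
    have h0 : Tendsto (fun y => s y * (y - p.2.1) ^ 4) (𝓝 p.2.1) (𝓝 0) :=
      hs1.isBigO.trans_tendsto htz
    have h1 : Tendsto (fun y => p.2.2 + c * (y - p.2.1)) (𝓝 p.2.1) (𝓝 p.2.2) :=
      (continuous_snd.comp continuous_snd).continuousAt.tendsto.comp ht0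
    have h2 := h1.add h0
    rw [add_zero] at h2
    exact tendsto_const_nhds.prodMk_nhds (tendsto_id.prodMk_nhds h2)
  have hdu : HasFDerivAt (du F) (fderiv ℝ (du F) p) p :=
    ((contDiffAt_du hF).differentiableAt (by simp)).hasFDerivAt
  have ho := hdu.isLittleO.comp_tendsto hts
  have hnorm : (fun y => ((p.1, y, p.2.2 + c * (y - p.2.1) + s y * (y - p.2.1) ^ 4) :
      ℝ × ℝ × ℝ) - p) =O[𝓝 p.2.1] fun y => y - p.2.1 := by
    have h1 : (fun y => c * (y - p.2.1) + s y * (y - p.2.1) ^ 4) =O[𝓝 p.2.1]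
        fun y => y - p.2.1 := ((isBigO_refl _ _).const_mul_left c).add hs1.isBigO
    have h2 := (isBigO_zero (E' := ℝ) (fun y => y - p.2.1) (𝓝 p.2.1)).prod_left
      ((isBigO_refl (fun y => y - p.2.1) (𝓝 p.2.1)).prod_left h1)
    refine h2.congr_left fun y => ?_
    simp [Prod.ext_iff, add_assoc, add_sub_cancel_left]
  -- First-order expansion of `F_u` at the intermediate point. Whatever `s` is, it moves that point
  -- by `o(y - x)` only, so the coefficient is the derivative of `F_u` along the line of slope `c`.
  have hA : (fun y => du F (p.1, y, p.2.2 + c * (y - p.2.1) + s y * (y - p.2.1) ^ 4) -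
      (du F p + (dx (du F) p + c * du (du F) p) * (y - p.2.1))) =o[𝓝 p.2.1]
      fun y => y - p.2.1 := by
    have h1 := (ho.trans_isBigO hnorm).add (hs1.const_mul_left (du (du F) p))
    refine h1.congr_left fun y => ?_
    have hv : ((p.1, y, p.2.2 + c * (y - p.2.1) + s y * (y - p.2.1) ^ 4) : ℝ × ℝ × ℝ) - p =
        (0, y - p.2.1, c * (y - p.2.1) + s y * (y - p.2.1) ^ 4) := by
      simp [Prod.ext_iff, add_assoc, add_sub_cancel_left]
    simp only [Function.comp, hv, fderiv_eq_partials]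
    ring
  have hfin := hA.mul_isBigO (isBigO_refl (fun y => (y - p.2.1) ^ 4) (𝓝 p.2.1))
  refine hfin.congr' ?_ (Eventually.of_forall fun y => by ring)
  filter_upwards [ht1.eventually (Metric.ball_mem_nhds p hr),
    ht0.eventually (Metric.ball_mem_nhds p hr)] with y hy1 hy0
  rw [hsF y hy1 hy0]
  ring

end Partials

namespace Transformation

variable {Φ : Transformation} {Ω : Set (ℝ × ℝ × ℝ)}

section Evaluation

variable {u v : ℝ × ℝ → ℝ} {q : ℝ × ℝ}

theorem MapsJet.apply_newIndep (h : Φ.MapsJet u v q) :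
    v (Φ.newIndep u q) = Φ.U (q.1, q.2, u q) := h.2.2.2.self_of_nhds

theorem MapsJet.contDiffAt_slice (h : Φ.MapsJet u v q) :
    ContDiffAt ℝ ∞ (fun y => v ((Φ.newIndep u q).1, y)) (Φ.newIndep u q).2 :=
  ContDiffAt.comp (f := fun y : ℝ => ((Φ.newIndep u q).1, y)) (Φ.newIndep u q).2 h.2.2.1
    (contDiffAt_const.prodMk contDiffAt_id)

theorem MapsJet.lhs_eq (h : Φ.MapsJet u v q) (E : Equation) :
    E.lhs v (Φ.newIndep u q) =
      deriv (fun s => v (s, (Φ.newIndep u q).2)) (Φ.newIndep u q).1 +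
      Φ.U (q.1, q.2, u q) * deriv (fun y => v ((Φ.newIndep u q).1, y)) (Φ.newIndep u q).2 +
      E.β (Φ.T (q.1, q.2, u q)) *
        iteratedDeriv 3 (fun y => v ((Φ.newIndep u q).1, y)) (Φ.newIndep u q).2 +
      E.σ (Φ.T (q.1, q.2, u q)) *
        iteratedDeriv 5 (fun y => v ((Φ.newIndep u q).1, y)) (Φ.newIndep u q).2 := by
  rw [Equation.lhs, h.apply_newIndep]
  rfl

theorem tendsto_graph_slice (hu : ContinuousAt u q) :
    Tendsto (fun y => (y, u (q.1, y))) (𝓝 q.2) (𝓝 (q.2, u q)) := by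
  have hc : Tendsto (fun y : ℝ => (q.1, y)) (𝓝 q.2) (𝓝 q) :=
    (show Continuous fun y : ℝ => (q.1, y) by fun_prop).tendsto q.2
  exact tendsto_id.prodMk_nhds (hu.tendsto.comp hc)

/-- Along the slice `t = q.1` the new function is a function of one variable. -/
theorem MapsJet.eventually_slice (h : Φ.MapsJet u v q)
    (hTs : ∀ᶠ z in 𝓝 (q.2, u q), Φ.T (q.1, z) = Φ.T (q.1, q.2, u q)) :
    ∀ᶠ y in 𝓝 q.2, v ((Φ.newIndep u q).1, Φ.X (q.1, y, u (q.1, y))) =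
      Φ.U (q.1, y, u (q.1, y)) := by
  filter_upwards [h.eventually_right, (tendsto_graph_slice h.1.continuousAt).eventually hTs]
    with y hy hTy
  rw [← hy, hTy]
  rfl

end Evaluation

/-! ### The coefficient of the fifth derivative. -/

section Symbol

theorem IsUsualEquivalence.eventually_T (h : Φ.IsUsualEquivalence Ω) (hΩ : IsOpen Ω)
    {p : ℝ × ℝ × ℝ} (hp : p ∈ Ω) : ∀ᶠ z in 𝓝 p.2, Φ.T (p.1, z) = Φ.T p := by
  have h1 := eventually_slice_eq_affine (F := Φ.T) (p := p) (a := 0) (b := 0) ((eventually_slice_mem hΩ hp).mono fun z hz =>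
    ⟨(h.1.contDiffAt_T hΩ hz).differentiableAt (by simp), h.dx_T hΩ hz, h.du_T hΩ hz⟩)
  exact h1.mono fun z hz => by rw [hz]; ring

/-- The source of all splitting: `c`, `c₃`, `c₄`, `c₅` may be prescribed freely as long as `s` is
solved from the equation and `D_x X` does not vanish. -/
theorem IsUsualEquivalence.exists_mapsJet_testFun (h : Φ.IsUsualEquivalence Ω) (hΩ : IsOpen Ω)
    {p : ℝ × ℝ × ℝ} (hp : p ∈ Ω) {E E' : Equation} (hE : Φ.MapsEquation Ω E E') (hpE : p.1 ∈ E.I)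
    {s c c₃ c₄ c₅ : ℝ} (hc : dx Φ.X p + c * du Φ.X p ≠ 0)
    (hs : s + p.2.2 * c + E.β p.1 * (6 * c₃) + E.σ p.1 * (120 * c₅) = 0) :
    ∃ v, Φ.MapsJet (testFun (p.1, p.2.1) s p.2.2 c c₃ c₄ c₅) v (p.1, p.2.1) ∧
      E'.lhs v (Φ.newIndep (testFun (p.1, p.2.1) s p.2.2 c c₃ c₄ c₅) (p.1, p.2.1)) = 0 := by
  set u := testFun (p.1, p.2.1) s p.2.2 c c₃ c₄ c₅ with hu_def
  have hup : ((p.1, p.2.1).1, (p.1, p.2.1).2, u (p.1, p.2.1)) = p := by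
    rw [hu_def, testFun_self]
  have hux : deriv (fun y => u ((p.1, p.2.1).1, y)) (p.1, p.2.1).2 = c :=
    deriv_testFun_right (p.1, p.2.1) s p.2.2 c c₃ c₄ c₅
  obtain ⟨v, hv⟩ := exists_mapsJet (Φ := Φ) (u := u) (q := (p.1, p.2.1))
    (contDiff_testFun _ _ _ _ _ _ _).contDiffAt
    (by rw [hup]; exact h.1.contDiffAt_T hΩ hp) (by rw [hup]; exact h.1.contDiffAt_X hΩ hp)
    (by rw [hup]; exact h.1.contDiffAt_U hΩ hp) (by rw [hup]; exact h.dx_T hΩ hp)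
    (by rw [hup]; exact h.du_T hΩ hp) (by rw [hup]; exact h.dt_T_ne_zero hΩ hp)
    (by rw [hup, hux]; exact hc)
  refine ⟨v, hv, (hE.2 (p.1, p.2.1) u v hpE (by rw [hup]; exact hp) hv).1 ?_⟩
  rw [hu_def, lhs_testFun]
  exact hs

/-- Comparison of the coefficients of the fifth derivative of `u`. -/
theorem IsUsualEquivalence.symbol (h : Φ.IsUsualEquivalence Ω) (hΩ : IsOpen Ω)
    {p : ℝ × ℝ × ℝ} (hp : p ∈ Ω) {E E' : Equation} (hE : Φ.MapsEquation Ω E E') (hpE : p.1 ∈ E.I)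
    {c : ℝ} (hc : dx Φ.X p + c * du Φ.X p ≠ 0) :
    dt Φ.T p * E'.σ (Φ.T p) = E.σ p.1 * (dx Φ.X p + c * du Φ.X p) ^ 5 := by
  obtain ⟨t, x, a⟩ := p
  simp only at hpE ⊢
  -- Two jets on the equation with the same lower `x`-derivatives: `u_xxxxx` grows by `120 = 5!`,
  -- and `u_t` compensates by `-120 σ`.
  obtain ⟨v₀, hv₀, hl₀⟩ := h.exists_mapsJet_testFun hΩ hp hE hpE (s := -(a * c)) (c₃ := 0)
    (c₄ := 0) (c₅ := 0) hc (by simp)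
  obtain ⟨v₁, hv₁, hl₁⟩ := h.exists_mapsJet_testFun hΩ hp hE hpE
    (s := -(a * c) - E.σ t * 120) (c₃ := 0) (c₄ := 0) (c₅ := 1) hc (by simp; ring)
  simp only at hv₀ hl₀ hv₁ hl₁
  set u₀ := testFun (t, x) (-(a * c)) a c 0 0 0 with hu₀
  set u₁ := testFun (t, x) (-(a * c) - E.σ t * 120) a c 0 0 1 with hu₁
  have hu₀q : u₀ (t, x) = a := testFun_self _ _ _ _ _ _ _
  have hu₁q : u₁ (t, x) = a := testFun_self _ _ _ _ _ _ _
  have hu₀x : deriv (fun y => u₀ (t, y)) x = c := deriv_testFun_right (t, x) _ _ _ _ _ _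
  have hu₁x : deriv (fun y => u₁ (t, y)) x = c := deriv_testFun_right (t, x) _ _ _ _ _ _
  have hu₀t : deriv (fun s => u₀ (s, x)) t = -(a * c) := deriv_testFun_left (t, x) _ _ _ _ _ _
  have hu₁t : deriv (fun s => u₁ (s, x)) t = -(a * c) - E.σ t * 120 :=
    deriv_testFun_left (t, x) _ _ _ _ _ _
  have hN₀ : Φ.newIndep u₀ (t, x) = (Φ.T (t, x, a), Φ.X (t, x, a)) := by
    simp only [newIndep, hu₀q]
  have hN₁ : Φ.newIndep u₁ (t, x) = (Φ.T (t, x, a), Φ.X (t, x, a)) := by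
    simp only [newIndep, hu₁q]
  have hTd := (h.1.contDiffAt_T hΩ hp).differentiableAt (by simp)
  have hXs := h.1.contDiffAt_X hΩ hp
  have hUs := h.1.contDiffAt_U hΩ hp
  have hXd := hXs.differentiableAt (by simp)
  have hUd := hUs.differentiableAt (by simp)
  have hsl₀ := hv₀.eventually_slice (by simpa only [hu₀q] using h.eventually_T hΩ hp)
  have hsl₁ := hv₁.eventually_slice (by simpa only [hu₁q] using h.eventually_T hΩ hp)
  obtain ⟨ht₀, hx₀⟩ := hv₀.chain_rule (by simpa only [hu₀q] using hTd)
    (by simpa only [hu₀q] using hXd) (by simpa only [hu₀q] using hUd)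
    (by simpa only [hu₀q] using h.dx_T hΩ hp) (by simpa only [hu₀q] using h.du_T hΩ hp)
  obtain ⟨ht₁, hx₁⟩ := hv₁.chain_rule (by simpa only [hu₁q] using hTd)
    (by simpa only [hu₁q] using hXd) (by simpa only [hu₁q] using hUd)
    (by simpa only [hu₁q] using h.dx_T hΩ hp) (by simpa only [hu₁q] using h.du_T hΩ hp)
  rw [hv₀.lhs_eq] at hl₀
  rw [hv₁.lhs_eq] at hl₁
  have hw₀ := hv₀.contDiffAt_slice
  have hw₁ := hv₁.contDiffAt_slice
  simp only [hN₀, hu₀q, hu₀x, hu₀t] at hsl₀ ht₀ hx₀ hl₀ hw₀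
  simp only [hN₁, hu₁q, hu₁x, hu₁t] at hsl₁ ht₁ hx₁ hl₁ hw₁
  have hu₀s : ContDiff ℝ ∞ fun y => u₀ (t, y) :=
    (contDiff_testFun _ _ _ _ _ _ _).comp (by fun_prop)
  have hu₁s : ContDiff ℝ ∞ fun y => u₁ (t, y) :=
    (contDiff_testFun _ _ _ _ _ _ _).comp (by fun_prop)
  have htu₀ : Tendsto (fun y => u₀ (t, y)) (𝓝 x) (𝓝 a) := by
    simpa [hu₀q] using hu₀s.continuous.tendsto x
  have htu₁ : Tendsto (fun y => u₁ (t, y)) (𝓝 x) (𝓝 a) := by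
    simpa [hu₁q] using hu₁s.continuous.tendsto x
  have hδ : ∀ y, u₁ (t, y) - u₀ (t, y) = (y - x) ^ 5 := by
    intro y; simp only [hu₀, hu₁, testFun]; ring
  have hδX := isLittleO_sub_along hXs htu₀ htu₁
  have hδU := isLittleO_sub_along hUs htu₀ htu₁
  simp only [hδ] at hδX hδU
  have hξc : ∀ {F : ℝ × ℝ × ℝ → ℝ} {w : ℝ × ℝ → ℝ}, ContDiffAt ℝ ∞ F (t, x, a) →
      (ContDiff ℝ ∞ fun y => w (t, y)) → w (t, x) = a →
      ContDiffAt ℝ ∞ (fun y => F (t, y, w (t, y))) x := by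
    intro F w hF hw hwa
    have hF' : ContDiffAt ℝ ∞ F (t, x, w (t, x)) := by rw [hwa]; exact hF
    exact ContDiffAt.comp (f := fun y => (t, y, w (t, y))) x hF'
      (contDiffAt_const.prodMk (contDiffAt_id.prodMk hw.contDiffAt))
  have hξ : HasStrictDerivAt (fun y => Φ.X (t, y, u₀ (t, y)))
      (dx Φ.X (t, x, a) + c * du Φ.X (t, x, a)) x := by
    have h1 := hasDerivAt_comp_graph_right (F := Φ.X) (u := u₀) (q := (t, x))
      (by simpa only [hu₀q] using hXd)
      ((contDiff_testFun _ _ _ _ _ _ _).differentiable (by simp) _)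
    simp only [hu₀q, hu₀x] at h1
    exact (hξc hXs hu₀s hu₀q).hasStrictDerivAt' h1 (by simp)
  have hw₁s := hw₁.hasStrictDerivAt (by simp)
  have ho := sub_isLittleO_of_comp (w₀ := fun y => v₀ (Φ.T (t, x, a), y))
    (w₁ := fun y => v₁ (Φ.T (t, x, a), y)) (ξ₀ := fun y => Φ.X (t, y, u₀ (t, y)))
    (ξ₁ := fun y => Φ.X (t, y, u₁ (t, y))) (η₀ := fun y => Φ.U (t, y, u₀ (t, y)))
    (η₁ := fun y => Φ.U (t, y, u₁ (t, y))) (x₀ := x) (A := du Φ.X (t, x, a))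
    (B := du Φ.U (t, x, a)) (ε := 1) hc hξ (by simp only [hu₀q, hu₁q])
    (hξc hXs hu₁s hu₁q).continuousAt (by simpa only [hu₀q] using hw₁s) hsl₀ hsl₁
    (by simpa only [one_mul] using hδX) (by simpa only [one_mul] using hδU)
  simp only [hu₀q] at ho
  obtain ⟨hd1, hd3, hd5⟩ := jet_eq_of_isLittleO (hw₁.of_le (WithTop.coe_le_coe.2 (le_top : (5 : ℕ∞) ≤ ⊤)))
    (hw₀.of_le (WithTop.coe_le_coe.2 (le_top : (5 : ℕ∞) ≤ ⊤))) ho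
  have hJ := h.jacobian_ne_zero hΩ hp
  set w1 := deriv (fun y => v₁ (Φ.T (t, x, a), y)) (Φ.X (t, x, a))
  set ξ := dx Φ.X (t, x, a) + c * du Φ.X (t, x, a) with hξ_def
  rw [← hd1] at hl₀ ht₀
  rw [hd3, hd5] at hl₁
  -- By the chain rule for `w1` this product is the Jacobian `X_x U_u - X_u U_x`.
  have hK : ξ * (du Φ.U (t, x, a) - w1 * du Φ.X (t, x, a)) ≠ 0 := by
    intro h0
    apply hJ
    have h2 : w1 * ξ = dx Φ.U (t, x, a) + c * du Φ.U (t, x, a) := by rw [← hx₁]; ring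
    linear_combination h0 + du Φ.X (t, x, a) * h2 - du Φ.U (t, x, a) * hξ_def
  have hK' : du Φ.U (t, x, a) - w1 * du Φ.X (t, x, a) ≠ 0 := right_ne_zero_of_mul hK
  -- Difference of the two transformed equations, with the change of the `t̃`-derivative of `v`
  -- eliminated by the chain rule.
  have hmain : (du Φ.U (t, x, a) - w1 * du Φ.X (t, x, a)) * 120 *
      (dt Φ.T (t, x, a) * E'.σ (Φ.T (t, x, a)) - E.σ t * ξ ^ 5) = 0 := by
    field_simp at hl₁
    linear_combination dt Φ.T (t, x, a) * hl₁ - dt Φ.T (t, x, a) * ξ ^ 5 * hl₀ -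
      ξ ^ 5 * (ht₁ - ht₀)
  have := (mul_eq_zero.1 hmain).resolve_left (mul_ne_zero hK' (by norm_num))
  linarith

end Symbol

end Transformation

section Partials

variable {F G : ℝ × ℝ × ℝ → ℝ} {p : ℝ × ℝ × ℝ}

theorem dt_congr (h : F =ᶠ[𝓝 p] G) : dt F p = dt G p := by rw [dt, dt, h.fderiv_eq]

theorem dx_congr (h : F =ᶠ[𝓝 p] G) : dx F p = dx G p := by rw [dx, dx, h.fderiv_eq]

theorem du_congr (h : F =ᶠ[𝓝 p] G) : du F p = du G p := by rw [du, du, h.fderiv_eq]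

@[simp]
theorem dt_const (a : ℝ) : dt (fun _ => a) p = 0 := by simp [dt]

@[simp]
theorem dx_const (a : ℝ) : dx (fun _ => a) p = 0 := by simp [dx]

@[simp]
theorem du_const (a : ℝ) : du (fun _ => a) p = 0 := by simp [du]

end Partials

namespace Transformation

variable {Φ : Transformation} {Ω : Set (ℝ × ℝ × ℝ)}

section Prolong

variable {u v : ℝ × ℝ → ℝ} {q : ℝ × ℝ}

/-- The transformation of the jets of `u` that enter the equation when `x̃` is affine in `x` and
`ũ` is affine in `u` along the fibres over `t`. -/
theorem MapsJet.prolong (h : Φ.MapsJet u v q) {g : ℝ → ℝ}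
    (hT : DifferentiableAt ℝ Φ.T (q.1, q.2, u q)) (hX : DifferentiableAt ℝ Φ.X (q.1, q.2, u q))
    (hU : DifferentiableAt ℝ Φ.U (q.1, q.2, u q))
    (hTx : dx Φ.T (q.1, q.2, u q) = 0) (hTu : du Φ.T (q.1, q.2, u q) = 0)
    (hXu : du Φ.X (q.1, q.2, u q) = 0)
    (hTs : ∀ᶠ z in 𝓝 (q.2, u q), Φ.T (q.1, z) = Φ.T (q.1, q.2, u q))
    (hXs : ∀ᶠ z in 𝓝 (q.2, u q), Φ.X (q.1, z) =
      Φ.X (q.1, q.2, u q) + dx Φ.X (q.1, q.2, u q) * (z.1 - q.2))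
    (hUs : ∀ᶠ z in 𝓝 (q.2, u q), Φ.U (q.1, z) = du Φ.U (q.1, q.2, u q) * z.2 + g z.1)
    (hg : ContDiffAt ℝ ∞ g q.2) :
    ∃ vt vx v₃ v₅ : ℝ, (∀ E : Equation, E.lhs v (Φ.newIndep u q) =
        vt + Φ.U (q.1, q.2, u q) * vx + E.β (Φ.T (q.1, q.2, u q)) * v₃ +
          E.σ (Φ.T (q.1, q.2, u q)) * v₅) ∧
      dt Φ.T (q.1, q.2, u q) * vt + dt Φ.X (q.1, q.2, u q) * vx =
        dt Φ.U (q.1, q.2, u q) + deriv (fun s => u (s, q.2)) q.1 * du Φ.U (q.1, q.2, u q) ∧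
      dx Φ.X (q.1, q.2, u q) * vx =
        dx Φ.U (q.1, q.2, u q) + deriv (fun y => u (q.1, y)) q.2 * du Φ.U (q.1, q.2, u q) ∧
      dx Φ.X (q.1, q.2, u q) ^ 3 * v₃ = du Φ.U (q.1, q.2, u q) *
        iteratedDeriv 3 (fun y => u (q.1, y)) q.2 + iteratedDeriv 3 g q.2 ∧
      dx Φ.X (q.1, q.2, u q) ^ 5 * v₅ = du Φ.U (q.1, q.2, u q) *
        iteratedDeriv 5 (fun y => u (q.1, y)) q.2 + iteratedDeriv 5 g q.2 := by
  obtain ⟨h1, h2⟩ := h.chain_rule hT hX hU hTx hTu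
  rw [hXu, mul_zero, add_zero] at h1 h2
  have htz := tendsto_graph_slice h.1.continuousAt
  have hw : ∀ᶠ y in 𝓝 q.2, v ((Φ.newIndep u q).1,
      (Φ.newIndep u q).2 + dx Φ.X (q.1, q.2, u q) * (y - q.2)) =
      du Φ.U (q.1, q.2, u q) * u (q.1, y) + g y := by
    filter_upwards [h.eventually_slice hTs, htz.eventually hXs, htz.eventually hUs]
      with y hy hXy hUy
    rw [← hUy, ← hy, hXy]
    rfl
  have hus : ContDiffAt ℝ ∞ (fun y => u (q.1, y)) q.2 :=
    ContDiffAt.comp (f := fun y : ℝ => (q.1, y)) q.2 h.1 (contDiffAt_const.prodMk contDiffAt_id)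
  have hη : ∀ k : ℕ, iteratedDeriv k (fun y => du Φ.U (q.1, q.2, u q) * u (q.1, y) + g y) q.2 =
      du Φ.U (q.1, q.2, u q) * iteratedDeriv k (fun y => u (q.1, y)) q.2 +
        iteratedDeriv k g q.2 := by
    intro k
    have hk : (k : ℕ∞ω) ≤ ∞ := WithTop.coe_le_coe.2 (le_top : (k : ℕ∞) ≤ ⊤)
    have h3 := iteratedDeriv_add (n := k)
      ((contDiffAt_const (c := du Φ.U (q.1, q.2, u q))).mul (hus.of_le hk)) (hg.of_le hk)
    have h4 := iteratedDeriv_const_mul_field (n := k) (x := q.2) (du Φ.U (q.1, q.2, u q))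
      (fun y => u (q.1, y))
    rw [← h4]
    exact h3
  refine ⟨_, _, _, _, h.lhs_eq, h1 ▸ by ring, h2, ?_, ?_⟩
  · rw [← hη]
    exact iteratedDeriv_of_comp_affine (w := fun y => v ((Φ.newIndep u q).1, y)) hw 3
  · rw [← hη]
    exact iteratedDeriv_of_comp_affine (w := fun y => v ((Φ.newIndep u q).1, y)) hw 5

end Prolong

namespace IsUsualEquivalence

/-! ### The determining equations. -/

section Determining

/-- The left side of `symbol` does not contain `c`. Were `X_u` nonzero, `X_x + c X_u` could be given
the values 1 and 2, whose fifth powers differ. -/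
theorem du_X (h : Φ.IsUsualEquivalence Ω) (hΩ : IsOpen Ω) {p : ℝ × ℝ × ℝ} (hp : p ∈ Ω) :
    du Φ.X p = 0 := by
  by_contra hne
  obtain ⟨E', hE'⟩ := h.2 (expEquation p.1 1 1 0 0 one_ne_zero one_ne_zero)
  have key : ∀ m : ℝ, m ≠ 0 → dt Φ.T p * E'.σ (Φ.T p) = m ^ 5 := by
    intro m hm
    have hc : dx Φ.X p + (m - dx Φ.X p) / du Φ.X p * du Φ.X p = m := by field_simp; ring
    have h1 := h.symbol hΩ hp hE' (Set.mem_univ _) (c := (m - dx Φ.X p) / du Φ.X p)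
      (by rw [hc]; exact hm)
    rw [hc] at h1
    simpa [expEquation] using h1
  have h1 := key 1 one_ne_zero
  have h2 := key 2 two_ne_zero
  rw [h1] at h2
  norm_num at h2

theorem dx_X_mul_du_U_ne_zero (h : Φ.IsUsualEquivalence Ω) (hΩ : IsOpen Ω) {p : ℝ × ℝ × ℝ}
    (hp : p ∈ Ω) : dx Φ.X p * du Φ.U p ≠ 0 := by
  have := h.jacobian_ne_zero hΩ hp
  rwa [h.du_X hΩ hp, zero_mul, sub_zero] at this

theorem dx_X_ne_zero (h : Φ.IsUsualEquivalence Ω) (hΩ : IsOpen Ω) {p : ℝ × ℝ × ℝ}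
    (hp : p ∈ Ω) : dx Φ.X p ≠ 0 := left_ne_zero_of_mul (h.dx_X_mul_du_U_ne_zero hΩ hp)

theorem du_U_ne_zero (h : Φ.IsUsualEquivalence Ω) (hΩ : IsOpen Ω) {p : ℝ × ℝ × ℝ}
    (hp : p ∈ Ω) : du Φ.U p ≠ 0 := right_ne_zero_of_mul (h.dx_X_mul_du_U_ne_zero hΩ hp)

theorem dx_dt_T (h : Φ.IsUsualEquivalence Ω) (hΩ : IsOpen Ω) {p : ℝ × ℝ × ℝ} (hp : p ∈ Ω) :
    dx (dt Φ.T) p = 0 := by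
  rw [dx_dt (h.1.contDiffAt_T hΩ hp), dt_congr (G := fun _ => 0), dt_const]
  filter_upwards [hΩ.mem_nhds hp] with p' hp' using h.dx_T hΩ hp'

theorem du_dt_T (h : Φ.IsUsualEquivalence Ω) (hΩ : IsOpen Ω) {p : ℝ × ℝ × ℝ} (hp : p ∈ Ω) :
    du (dt Φ.T) p = 0 := by
  rw [du_dt (h.1.contDiffAt_T hΩ hp), dt_congr (G := fun _ => 0), dt_const]
  filter_upwards [hΩ.mem_nhds hp] with p' hp' using h.du_T hΩ hp'

theorem du_dx_X (h : Φ.IsUsualEquivalence Ω) (hΩ : IsOpen Ω) {p : ℝ × ℝ × ℝ} (hp : p ∈ Ω) :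
    du (dx Φ.X) p = 0 := by
  rw [du_dx (h.1.contDiffAt_X hΩ hp), dx_congr (G := fun _ => 0), dx_const]
  filter_upwards [hΩ.mem_nhds hp] with p' hp' using h.du_X hΩ hp'

theorem du_dt_X (h : Φ.IsUsualEquivalence Ω) (hΩ : IsOpen Ω) {p : ℝ × ℝ × ℝ} (hp : p ∈ Ω) :
    du (dt Φ.X) p = 0 := by
  rw [du_dt (h.1.contDiffAt_X hΩ hp), dt_congr (G := fun _ => 0), dt_const]
  filter_upwards [hΩ.mem_nhds hp] with p' hp' using h.du_X hΩ hp'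

/-- For the equation with `β = σ = 1`, `symbol` makes `X_x^5` equal to `T_t σ̃(T)`, whose
`x`-derivative vanishes. -/
theorem dx_dx_X (h : Φ.IsUsualEquivalence Ω) (hΩ : IsOpen Ω) {p : ℝ × ℝ × ℝ} (hp : p ∈ Ω) :
    dx (dx Φ.X) p = 0 := by
  obtain ⟨E', hE'⟩ := h.2 (expEquation p.1 1 1 0 0 one_ne_zero one_ne_zero)
  have key : (fun p' => dt Φ.T p' * E'.σ (Φ.T p')) =ᶠ[𝓝 p] fun p' => dx Φ.X p' ^ 5 := by
    filter_upwards [hΩ.mem_nhds hp] with p' hp'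
    have h1 := h.symbol hΩ hp' hE' (Set.mem_univ _) (c := 0)
      (by simpa using h.dx_X_ne_zero hΩ hp')
    simpa [expEquation] using h1
  have hT := h.1.contDiffAt_T hΩ hp
  have hσ : DifferentiableAt ℝ E'.σ (Φ.T p) :=
    (E'.smooth_σ.contDiffAt (E'.isOpen_I.mem_nhds
      (hE'.1 p hp (Set.mem_univ _)).1)).differentiableAt (by simp)
  have hl := (((contDiffAt_dt hT).differentiableAt (by simp)).hasFDerivAt).mul
    (hσ.hasDerivAt.comp_hasFDerivAt p (hT.differentiableAt (by simp)).hasFDerivAt)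
  have hr := (((contDiffAt_dx (h.1.contDiffAt_X hΩ hp)).differentiableAt
    (by simp)).hasFDerivAt).pow 5
  have he := congrArg (fun L => L (0, 1, 0)) ((hl.congr_of_eventuallyEq key.symm).unique hr)
  have h1 : fderiv ℝ (dt Φ.T) p (0, 1, 0) = 0 := h.dx_dt_T hΩ hp
  have h2 : fderiv ℝ Φ.T p (0, 1, 0) = 0 := h.dx_T hΩ hp
  simp [h1, h2, h.dx_X_ne_zero hΩ hp] at he
  exact he

theorem eventually_X (h : Φ.IsUsualEquivalence Ω) (hΩ : IsOpen Ω) {p : ℝ × ℝ × ℝ} (hp : p ∈ Ω) :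
    ∀ᶠ z in 𝓝 p.2, Φ.X (p.1, z) = Φ.X p + dx Φ.X p * (z.1 - p.2.1) := by
  have h1 := eventually_slice_eq_affine (F := dx Φ.X) (p := p) (a := 0) (b := 0)
    ((eventually_slice_mem hΩ hp).mono fun z hz =>
      ⟨(contDiffAt_dx (h.1.contDiffAt_X hΩ hz)).differentiableAt (by simp),
        h.dx_dx_X hΩ hz, h.du_dx_X hΩ hz⟩)
  have h2 := eventually_slice_eq_affine (F := Φ.X) (p := p) (a := dx Φ.X p) (b := 0)
    (((eventually_slice_mem hΩ hp).and h1).mono fun z hz =>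
      ⟨(h.1.contDiffAt_X hΩ hz.1).differentiableAt (by simp),
        by rw [hz.2]; ring, h.du_X hΩ hz.1⟩)
  exact h2.mono fun z hz => by rw [hz]; ring

/-- Comparison of the coefficients of the fourth derivative of `u`. -/
theorem dx_du_U_add (h : Φ.IsUsualEquivalence Ω) (hΩ : IsOpen Ω) {p : ℝ × ℝ × ℝ} (hp : p ∈ Ω)
    (c : ℝ) : dx (du Φ.U) p + c * du (du Φ.U) p = 0 := by
  obtain ⟨E', hE'⟩ := h.2 (expEquation p.1 1 1 0 0 one_ne_zero one_ne_zero)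
  set E := expEquation p.1 1 1 0 0 one_ne_zero one_ne_zero
  have hXu := h.du_X hΩ hp
  have hX1 := h.dx_X_ne_zero hΩ hp
  -- The two jets differ in `u_xxxx` alone. The equation does not contain it, so the same `s` serves
  -- both.
  obtain ⟨v₀, hv₀, hl₀⟩ := h.exists_mapsJet_testFun hΩ hp hE' (Set.mem_univ _) (s := -(p.2.2 * c))
    (c := c) (c₃ := 0) (c₄ := 0) (c₅ := 0) (by simpa [hXu] using hX1) (by simp)
  obtain ⟨v₁, hv₁, hl₁⟩ := h.exists_mapsJet_testFun hΩ hp hE' (Set.mem_univ _) (s := -(p.2.2 * c))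
    (c := c) (c₃ := 0) (c₄ := 1) (c₅ := 0) (by simpa [hXu] using hX1) (by simp)
  have hσ := E'.σ_ne_zero _ (hE'.1 p hp (Set.mem_univ _)).1
  have hTs := h.eventually_T hΩ hp
  have hXs := h.eventually_X hΩ hp
  obtain ⟨t, x, a⟩ := p
  simp only at hv₀ hl₀ hv₁ hl₁ hTs hXs
  set u₀ := testFun (t, x) (-(a * c)) a c 0 0 0 with hu₀
  set u₁ := testFun (t, x) (-(a * c)) a c 0 1 0 with hu₁
  have hu₀q : u₀ (t, x) = a := testFun_self _ _ _ _ _ _ _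
  have hu₁q : u₁ (t, x) = a := testFun_self _ _ _ _ _ _ _
  have hu₀x : deriv (fun y => u₀ (t, y)) x = c := deriv_testFun_right (t, x) _ _ _ _ _ _
  have hu₁x : deriv (fun y => u₁ (t, y)) x = c := deriv_testFun_right (t, x) _ _ _ _ _ _
  have hu₀t : deriv (fun s => u₀ (s, x)) t = -(a * c) := deriv_testFun_left (t, x) _ _ _ _ _ _
  have hu₁t : deriv (fun s => u₁ (s, x)) t = -(a * c) := deriv_testFun_left (t, x) _ _ _ _ _ _
  have hN₀ : Φ.newIndep u₀ (t, x) = (Φ.T (t, x, a), Φ.X (t, x, a)) := by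
    simp only [newIndep, hu₀q]
  have hN₁ : Φ.newIndep u₁ (t, x) = (Φ.T (t, x, a), Φ.X (t, x, a)) := by
    simp only [newIndep, hu₁q]
  have hTd := (h.1.contDiffAt_T hΩ hp).differentiableAt (by simp)
  have hXd := (h.1.contDiffAt_X hΩ hp).differentiableAt (by simp)
  have hUs := h.1.contDiffAt_U hΩ hp
  have hUd := hUs.differentiableAt (by simp)
  have hsl₀ := hv₀.eventually_slice (by simpa only [hu₀q] using hTs)
  have hsl₁ := hv₁.eventually_slice (by simpa only [hu₁q] using hTs)
  obtain ⟨ht₀, hx₀⟩ := hv₀.chain_rule (by simpa only [hu₀q] using hTd)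
    (by simpa only [hu₀q] using hXd) (by simpa only [hu₀q] using hUd)
    (by simpa only [hu₀q] using h.dx_T hΩ hp) (by simpa only [hu₀q] using h.du_T hΩ hp)
  obtain ⟨ht₁, hx₁⟩ := hv₁.chain_rule (by simpa only [hu₁q] using hTd)
    (by simpa only [hu₁q] using hXd) (by simpa only [hu₁q] using hUd)
    (by simpa only [hu₁q] using h.dx_T hΩ hp) (by simpa only [hu₁q] using h.du_T hΩ hp)
  have htz₀ := tendsto_graph_slice hv₀.1.continuousAt
  have htz₁ := tendsto_graph_slice hv₁.1.continuousAt
  rw [hv₀.lhs_eq] at hl₀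
  rw [hv₁.lhs_eq] at hl₁
  simp only [hN₀, hu₀q, hu₀x, hu₀t, hXu] at hsl₀ ht₀ hx₀ hl₀ htz₀
  simp only [hN₁, hu₁q, hu₁x, hu₁t, hXu] at hsl₁ ht₁ hx₁ hl₁ htz₁
  have hw₀ : ∀ᶠ y in 𝓝 x, (fun y => v₀ (Φ.T (t, x, a), y))
      (Φ.X (t, x, a) + dx Φ.X (t, x, a) * (y - x)) = Φ.U (t, y, u₀ (t, y)) := by
    filter_upwards [hsl₀, htz₀.eventually hXs] with y hy hXy
    rw [← hy, hXy]
  have hw₁ : ∀ᶠ y in 𝓝 x, (fun y => v₁ (Φ.T (t, x, a), y))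
      (Φ.X (t, x, a) + dx Φ.X (t, x, a) * (y - x)) = Φ.U (t, y, u₁ (t, y)) := by
    filter_upwards [hsl₁, htz₁.eventually hXs] with y hy hXy
    rw [← hy, hXy]
  have hη : ∀ {w : ℝ × ℝ → ℝ}, (ContDiff ℝ ∞ w) → w (t, x) = a →
      ContDiffAt ℝ 5 (fun y => Φ.U (t, y, w (t, y))) x := by
    intro w hw hwa
    have hU' : ContDiffAt ℝ ∞ Φ.U (t, x, w (t, x)) := by rw [hwa]; exact hUs
    have hws : ContDiff ℝ ∞ fun y => w (t, y) := hw.comp (by fun_prop)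
    have h1 : ContDiffAt ℝ ∞ (fun y => Φ.U (t, y, w (t, y))) x :=
      ContDiffAt.comp (f := fun y => (t, y, w (t, y))) x hU'
        (contDiffAt_const.prodMk (contDiffAt_id.prodMk hws.contDiffAt))
    exact h1.of_le (WithTop.coe_le_coe.2 (le_top : (5 : ℕ∞) ≤ ⊤))
  -- The quartic perturbation of `u` leaves the first and third derivatives of `U` along the graph
  -- unchanged and shifts the fifth by `120 (U_xu + c U_uu)`; subtracting the two equations leaves
  -- `σ̃` times this shift.
  have ho := isLittleO_sub_along_quartic hUs c
  obtain ⟨hd1, hd3, hd5⟩ := jet_eq_of_isLittleO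
    (hη (contDiff_testFun _ _ _ _ _ _ _) hu₁q) (hη (contDiff_testFun _ _ _ _ _ _ _) hu₀q)
    (a := du Φ.U (t, x, a)) (b := dx (du Φ.U) (t, x, a) + c * du (du Φ.U) (t, x, a))
    (ho.congr_left fun y => by simp [testFun])
  have i3₀ := iteratedDeriv_of_comp_affine (w := fun y => v₀ (Φ.T (t, x, a), y))
    (η := fun y => Φ.U (t, y, u₀ (t, y))) hw₀ 3
  have i3₁ := iteratedDeriv_of_comp_affine (w := fun y => v₁ (Φ.T (t, x, a), y))
    (η := fun y => Φ.U (t, y, u₁ (t, y))) hw₁ 3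
  have i5₀ := iteratedDeriv_of_comp_affine (w := fun y => v₀ (Φ.T (t, x, a), y))
    (η := fun y => Φ.U (t, y, u₀ (t, y))) hw₀ 5
  have i5₁ := iteratedDeriv_of_comp_affine (w := fun y => v₁ (Φ.T (t, x, a), y))
    (η := fun y => Φ.U (t, y, u₁ (t, y))) hw₁ 5
  change iteratedDeriv 3 (fun y => Φ.U (t, y, u₁ (t, y))) x =
    iteratedDeriv 3 (fun y => Φ.U (t, y, u₀ (t, y))) x at hd3
  change iteratedDeriv 5 (fun y => Φ.U (t, y, u₁ (t, y))) x =
    iteratedDeriv 5 (fun y => Φ.U (t, y, u₀ (t, y))) x + _ at hd5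
  rw [← i3₀, ← i3₁] at hd3
  rw [← i5₀, ← i5₁] at hd5
  have hd3' := mul_left_cancel₀ (pow_ne_zero 3 hX1) hd3
  have hx : deriv (fun y => v₁ (Φ.T (t, x, a), y)) (Φ.X (t, x, a)) =
      deriv (fun y => v₀ (Φ.T (t, x, a), y)) (Φ.X (t, x, a)) := by
    have h1 := hx₁.trans hx₀.symm
    rw [mul_zero, add_zero] at h1
    exact mul_left_cancel₀ hX1 h1
  have ht : deriv (fun s => v₁ (s, Φ.X (t, x, a))) (Φ.T (t, x, a)) =
      deriv (fun s => v₀ (s, Φ.X (t, x, a))) (Φ.T (t, x, a)) := by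
    have h1 := ht₁.trans ht₀.symm
    rw [hx] at h1
    exact mul_left_cancel₀ (h.dt_T_ne_zero hΩ hp) (add_right_cancel h1)
  rw [hd3', hx, ht] at hl₁
  have hmain : E'.σ (Φ.T (t, x, a)) * 120 *
      (dx (du Φ.U) (t, x, a) + c * du (du Φ.U) (t, x, a)) = 0 := by
    linear_combination dx Φ.X (t, x, a) ^ 5 * (hl₁ - hl₀) - E'.σ (Φ.T (t, x, a)) * hd5
  exact (mul_eq_zero.1 hmain).resolve_left (mul_ne_zero hσ (by norm_num))

theorem dx_du_U (h : Φ.IsUsualEquivalence Ω) (hΩ : IsOpen Ω) {p : ℝ × ℝ × ℝ} (hp : p ∈ Ω) :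
    dx (du Φ.U) p = 0 := by simpa using h.dx_du_U_add hΩ hp 0

theorem du_du_U (h : Φ.IsUsualEquivalence Ω) (hΩ : IsOpen Ω) {p : ℝ × ℝ × ℝ} (hp : p ∈ Ω) :
    du (du Φ.U) p = 0 := by simpa [h.dx_du_U hΩ hp] using h.dx_du_U_add hΩ hp 1

theorem eventually_U (h : Φ.IsUsualEquivalence Ω) (hΩ : IsOpen Ω) {p : ℝ × ℝ × ℝ} (hp : p ∈ Ω) :
    ∀ᶠ z in 𝓝 p.2, Φ.U (p.1, z) =
      du Φ.U p * z.2 + (Φ.U (p.1, z.1, p.2.2) - du Φ.U p * p.2.2) := by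
  have h1 := eventually_slice_eq_affine (F := du Φ.U) (p := p) (a := 0) (b := 0)
    ((eventually_slice_mem hΩ hp).mono fun z hz =>
      ⟨(contDiffAt_du (h.1.contDiffAt_U hΩ hz)).differentiableAt (by simp),
        h.dx_du_U hΩ hz, h.du_du_U hΩ hz⟩)
  exact eventually_slice_eq_affine_right (((eventually_slice_mem hΩ hp).and h1).mono fun z hz =>
    ⟨(h.1.contDiffAt_U hΩ hz.1).differentiableAt (by simp), by rw [hz.2]; ring⟩)

/-- The determining equations that remain after the top-order ones. -/
theorem exists_determining (h : Φ.IsUsualEquivalence Ω) (hΩ : IsOpen Ω) {p : ℝ × ℝ × ℝ}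
    (hp : p ∈ Ω) : ∃ g₃ g₅ : ℝ, ∀ β σ : ℝ, β ≠ 0 → σ ≠ 0 →
      dt Φ.T p * Φ.S (p, β, σ) = σ * dx Φ.X p ^ 5 ∧
      dt Φ.T p * Φ.B (p, β, σ) = β * dx Φ.X p ^ 3 ∧
      dt Φ.X p = dt Φ.T p * Φ.U p - p.2.2 * dx Φ.X p ∧
      dt Φ.U p + p.2.2 * dx Φ.U p + β * g₃ + σ * g₅ = 0 := by
  -- These are `U_xxx` and `U_xxxxx`. They are chosen before `β` and `σ`, so the last equation can
  -- afterwards be split in the coefficients.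
  refine ⟨iteratedDeriv 3 (fun y => Φ.U (p.1, y, p.2.2) - du Φ.U p * p.2.2) p.2.1,
    iteratedDeriv 5 (fun y => Φ.U (p.1, y, p.2.2) - du Φ.U p * p.2.2) p.2.1, fun β σ hβ hσ => ?_⟩
  set g := fun y => Φ.U (p.1, y, p.2.2) - du Φ.U p * p.2.2
  have hUs := h.1.contDiffAt_U hΩ hp
  have hg : ContDiffAt ℝ ∞ g p.2.1 := by
    have h1 : ContDiffAt ℝ ∞ (fun y => Φ.U (p.1, y, p.2.2)) p.2.1 :=
      ContDiffAt.comp (g := Φ.U) (f := fun y => (p.1, y, p.2.2)) p.2.1 hUs (by fun_prop)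
    exact h1.sub contDiffAt_const
  obtain ⟨E', hE'⟩ := h.2 (expEquation p.1 β σ 0 0 hβ hσ)
  have hX1 := h.dx_X_ne_zero hΩ hp
  have hA := h.du_U_ne_zero hΩ hp
  obtain ⟨-, hβ', hσ'⟩ := hE'.1 p hp (Set.mem_univ _)
  simp only [expEquation, zero_mul, Real.exp_zero, mul_one] at hβ' hσ'
  -- The transformed equation times `T_t X_x^5`, with the derivatives of `v` eliminated: a
  -- polynomial identity in the free jet coordinates.
  have key : ∀ c c₃ c₅ : ℝ,
      dx Φ.X p ^ 5 * (dt Φ.U p - (p.2.2 * c + β * (6 * c₃) + σ * (120 * c₅)) * du Φ.U p) +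
      (dx Φ.U p + c * du Φ.U p) * dx Φ.X p ^ 4 * (dt Φ.T p * Φ.U p - dt Φ.X p) +
      dt Φ.T p * E'.β (Φ.T p) * dx Φ.X p ^ 2 * (du Φ.U p * (6 * c₃) + iteratedDeriv 3 g p.2.1) +
      dt Φ.T p * E'.σ (Φ.T p) * (du Φ.U p * (120 * c₅) + iteratedDeriv 5 g p.2.1) = 0 := by
    intro c c₃ c₅
    have hEβ : (expEquation p.1 β σ 0 0 hβ hσ).β p.1 = β := by simp [expEquation]
    have hEσ : (expEquation p.1 β σ 0 0 hβ hσ).σ p.1 = σ := by simp [expEquation]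
    obtain ⟨v, hv, hl⟩ := h.exists_mapsJet_testFun hΩ hp hE' (Set.mem_univ _)
      (s := -(p.2.2 * c + β * (6 * c₃) + σ * (120 * c₅))) (c := c) (c₃ := c₃) (c₄ := 0) (c₅ := c₅)
      (by simpa [h.du_X hΩ hp] using hX1) (by rw [hEβ, hEσ]; ring)
    obtain ⟨i1, i3, i5⟩ := iteratedDeriv_quintic p.2.2 c c₃ 0 c₅ p.2.1
    have hTd := (h.1.contDiffAt_T hΩ hp).differentiableAt (by simp)
    have hXd := (h.1.contDiffAt_X hΩ hp).differentiableAt (by simp)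
    have hUd := hUs.differentiableAt (by simp)
    obtain ⟨vt, vx, v₃, v₅, h0, h1, h2, h3, h4⟩ := hv.prolong (g := g)
      (by simpa using hTd) (by simpa using hXd) (by simpa using hUd)
      (by simpa using h.dx_T hΩ hp) (by simpa using h.du_T hΩ hp) (by simpa using h.du_X hΩ hp)
      (by simpa using h.eventually_T hΩ hp) (by simpa using h.eventually_X hΩ hp)
      (by simpa using h.eventually_U hΩ hp) hg
    rw [h0] at hl
    have e1 := deriv_testFun_left (p.1, p.2.1) (-(p.2.2 * c + β * (6 * c₃) + σ * (120 * c₅)))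
      p.2.2 c c₃ 0 c₅
    have e3 := testFun_slice (p.1, p.2.1) (-(p.2.2 * c + β * (6 * c₃) + σ * (120 * c₅)))
      p.2.2 c c₃ 0 c₅
    simp only at e1 e3
    simp only [testFun_self, e1, e3, i1, i3, i5] at hl h1 h2 h3 h4
    linear_combination dt Φ.T p * dx Φ.X p ^ 5 * hl - dx Φ.X p ^ 5 * h1 -
      dx Φ.X p ^ 4 * (dt Φ.T p * Φ.U p - dt Φ.X p) * h2 -
      dt Φ.T p * E'.β (Φ.T p) * dx Φ.X p ^ 2 * h3 - dt Φ.T p * E'.σ (Φ.T p) * h4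
  -- The identity is affine in `(c, c₃, c₅)`, so four evaluations give all its coefficients.
  have k0 := key 0 0 0
  have k1 := key 1 0 0
  have k3 := key 0 1 0
  have k5 := key 0 0 1
  have r5 : dt Φ.T p * E'.σ (Φ.T p) = σ * dx Φ.X p ^ 5 := by
    refine mul_left_cancel₀ (mul_ne_zero hA (by norm_num : (120 : ℝ) ≠ 0)) ?_
    linear_combination k5 - k0
  have r3 : dt Φ.T p * E'.β (Φ.T p) = β * dx Φ.X p ^ 3 := by
    refine mul_left_cancel₀ (mul_ne_zero (mul_ne_zero hA (by norm_num : (6 : ℝ) ≠ 0))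
      (pow_ne_zero 2 hX1)) ?_
    linear_combination k3 - k0
  have r1 : dt Φ.X p = dt Φ.T p * Φ.U p - p.2.2 * dx Φ.X p := by
    refine mul_left_cancel₀ (mul_ne_zero hA (pow_ne_zero 4 hX1)) ?_
    linear_combination k0 - k1
  refine ⟨hσ' ▸ r5, hβ' ▸ r3, r1, mul_left_cancel₀ (pow_ne_zero 5 hX1) ?_⟩
  linear_combination k0 + dx Φ.U p * dx Φ.X p ^ 4 * r1 -
    dx Φ.X p ^ 2 * iteratedDeriv 3 g p.2.1 * r3 - iteratedDeriv 5 g p.2.1 * r5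

theorem S_eq (h : Φ.IsUsualEquivalence Ω) (hΩ : IsOpen Ω) {p : ℝ × ℝ × ℝ} (hp : p ∈ Ω) {β σ : ℝ}
    (hβ : β ≠ 0) (hσ : σ ≠ 0) : dt Φ.T p * Φ.S (p, β, σ) = σ * dx Φ.X p ^ 5 := by
  obtain ⟨g₃, g₅, hd⟩ := h.exists_determining hΩ hp
  exact (hd β σ hβ hσ).1

theorem B_eq (h : Φ.IsUsualEquivalence Ω) (hΩ : IsOpen Ω) {p : ℝ × ℝ × ℝ} (hp : p ∈ Ω) {β σ : ℝ}
    (hβ : β ≠ 0) (hσ : σ ≠ 0) : dt Φ.T p * Φ.B (p, β, σ) = β * dx Φ.X p ^ 3 := by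
  obtain ⟨g₃, g₅, hd⟩ := h.exists_determining hΩ hp
  exact (hd β σ hβ hσ).2.1

theorem dt_X_eq (h : Φ.IsUsualEquivalence Ω) (hΩ : IsOpen Ω) {p : ℝ × ℝ × ℝ} (hp : p ∈ Ω) :
    dt Φ.X p = dt Φ.T p * Φ.U p - p.2.2 * dx Φ.X p := by
  obtain ⟨g₃, g₅, hd⟩ := h.exists_determining hΩ hp
  exact (hd 1 1 one_ne_zero one_ne_zero).2.2.1

/-- The terms `β g₃ + σ g₅` change sign with `(β, σ)`, so they cancel in the sum of two instances.
-/
theorem dt_U_eq (h : Φ.IsUsualEquivalence Ω) (hΩ : IsOpen Ω) {p : ℝ × ℝ × ℝ} (hp : p ∈ Ω) :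
    dt Φ.U p = -(p.2.2 * dx Φ.U p) := by
  obtain ⟨g₃, g₅, hd⟩ := h.exists_determining hΩ hp
  have h1 := (hd 1 1 one_ne_zero one_ne_zero).2.2.2
  have h2 := (hd (-1) (-1) (by norm_num) (by norm_num)).2.2.2
  linarith

end Determining

end IsUsualEquivalence

end Transformation

/-! ### Rules for partial derivatives. -/

section Partials

variable {F G : ℝ × ℝ × ℝ → ℝ} {p : ℝ × ℝ × ℝ}

theorem fderiv_mul_apply (hF : DifferentiableAt ℝ F p) (hG : DifferentiableAt ℝ G p)
    (w : ℝ × ℝ × ℝ) : fderiv ℝ (fun p => F p * G p) p w =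
      fderiv ℝ F p w * G p + F p * fderiv ℝ G p w := by
  rw [fderiv_fun_mul hF hG]
  simp only [add_apply, smul_apply, smul_eq_mul]
  ring

theorem dt_mul (hF : DifferentiableAt ℝ F p) (hG : DifferentiableAt ℝ G p) :
    dt (fun p => F p * G p) p = dt F p * G p + F p * dt G p := fderiv_mul_apply hF hG _

theorem dx_mul (hF : DifferentiableAt ℝ F p) (hG : DifferentiableAt ℝ G p) :
    dx (fun p => F p * G p) p = dx F p * G p + F p * dx G p := fderiv_mul_apply hF hG _

theorem du_mul (hF : DifferentiableAt ℝ F p) (hG : DifferentiableAt ℝ G p) :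
    du (fun p => F p * G p) p = du F p * G p + F p * du G p := fderiv_mul_apply hF hG _

theorem dt_add (hF : DifferentiableAt ℝ F p) (hG : DifferentiableAt ℝ G p) :
    dt (fun p => F p + G p) p = dt F p + dt G p := by
  rw [dt, fderiv_fun_add hF hG]; rfl

theorem dx_add (hF : DifferentiableAt ℝ F p) (hG : DifferentiableAt ℝ G p) :
    dx (fun p => F p + G p) p = dx F p + dx G p := by
  rw [dx, fderiv_fun_add hF hG]; rfl

theorem du_add (hF : DifferentiableAt ℝ F p) (hG : DifferentiableAt ℝ G p) :
    du (fun p => F p + G p) p = du F p + du G p := by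
  rw [du, fderiv_fun_add hF hG]; rfl

theorem dt_sub (hF : DifferentiableAt ℝ F p) (hG : DifferentiableAt ℝ G p) :
    dt (fun p => F p - G p) p = dt F p - dt G p := by
  rw [dt, fderiv_fun_sub hF hG]; rfl

theorem dx_sub (hF : DifferentiableAt ℝ F p) (hG : DifferentiableAt ℝ G p) :
    dx (fun p => F p - G p) p = dx F p - dx G p := by
  rw [dx, fderiv_fun_sub hF hG]; rfl

theorem du_sub (hF : DifferentiableAt ℝ F p) (hG : DifferentiableAt ℝ G p) :
    du (fun p => F p - G p) p = du F p - du G p := by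
  rw [du, fderiv_fun_sub hF hG]; rfl

theorem fderiv_coord_t : fderiv ℝ (fun p : ℝ × ℝ × ℝ => p.1) p =
    ContinuousLinearMap.fst ℝ ℝ (ℝ × ℝ) := fderiv_fst

theorem fderiv_coord_x : fderiv ℝ (fun p : ℝ × ℝ × ℝ => p.2.1) p =
    (ContinuousLinearMap.fst ℝ ℝ ℝ).comp (ContinuousLinearMap.snd ℝ ℝ (ℝ × ℝ)) :=
  ((ContinuousLinearMap.fst ℝ ℝ ℝ).comp (ContinuousLinearMap.snd ℝ ℝ (ℝ × ℝ))).hasFDerivAt.fderiv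

theorem fderiv_coord_u : fderiv ℝ (fun p : ℝ × ℝ × ℝ => p.2.2) p =
    (ContinuousLinearMap.snd ℝ ℝ ℝ).comp (ContinuousLinearMap.snd ℝ ℝ (ℝ × ℝ)) :=
  ((ContinuousLinearMap.snd ℝ ℝ ℝ).comp (ContinuousLinearMap.snd ℝ ℝ (ℝ × ℝ))).hasFDerivAt.fderiv

theorem dt_coord_t : dt (fun p => p.1) p = 1 := by rw [dt, fderiv_coord_t]; simp

theorem dx_coord_t : dx (fun p => p.1) p = 0 := by rw [dx, fderiv_coord_t]; simp

theorem du_coord_t : du (fun p => p.1) p = 0 := by rw [du, fderiv_coord_t]; simp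

theorem dt_coord_x : dt (fun p => p.2.1) p = 0 := by rw [dt, fderiv_coord_x]; simp

theorem dx_coord_x : dx (fun p => p.2.1) p = 1 := by rw [dx, fderiv_coord_x]; simp

theorem du_coord_x : du (fun p => p.2.1) p = 0 := by rw [du, fderiv_coord_x]; simp

theorem dt_coord_u : dt (fun p => p.2.2) p = 0 := by rw [dt, fderiv_coord_u]; simp

theorem dx_coord_u : dx (fun p => p.2.2) p = 0 := by rw [dx, fderiv_coord_u]; simp

theorem du_coord_u : du (fun p => p.2.2) p = 1 := by rw [du, fderiv_coord_u]; simp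

theorem exists_eq_const_of_partials {Ω : Set (ℝ × ℝ × ℝ)} (hΩ : IsOpen Ω) (hc : IsPreconnected Ω)
    (hF : ∀ p ∈ Ω, DifferentiableAt ℝ F p)
    (h : ∀ p ∈ Ω, dt F p = 0 ∧ dx F p = 0 ∧ du F p = 0) : ∃ a, ∀ p ∈ Ω, F p = a := by
  refine hΩ.exists_is_const_of_fderiv_eq_zero (𝕜 := ℝ) hc
    (fun p hp => (hF p hp).differentiableWithinAt) fun p hp => ?_
  obtain ⟨h1, h2, h3⟩ := h p hp
  refine ContinuousLinearMap.ext fun w => ?_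
  rw [show w = (w.1, w.2.1, w.2.2) from rfl, fderiv_eq_partials, h1, h2, h3]
  simp

end Partials

namespace Transformation

namespace IsUsualEquivalence

variable {Φ : Transformation} {Ω : Set (ℝ × ℝ × ℝ)}

/-! ### Integration of the determining equations. -/

section Integration

/-- The `u`-derivative of `X_t + u X_x = T_t U`. -/
theorem dx_X_eq (h : Φ.IsUsualEquivalence Ω) (hΩ : IsOpen Ω) {p : ℝ × ℝ × ℝ} (hp : p ∈ Ω) :
    dx Φ.X p = dt Φ.T p * du Φ.U p := by
  have dT := (contDiffAt_dt (h.1.contDiffAt_T hΩ hp)).differentiableAt (by simp)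
  have dU := (h.1.contDiffAt_U hΩ hp).differentiableAt (by simp)
  have dX := (contDiffAt_dx (h.1.contDiffAt_X hΩ hp)).differentiableAt (by simp)
  have h1 : du (dt Φ.X) p = du (fun p => dt Φ.T p * Φ.U p - p.2.2 * dx Φ.X p) p := by
    refine du_congr ?_
    filter_upwards [hΩ.mem_nhds hp] with p' hp' using h.dt_X_eq hΩ hp'
  rw [h.du_dt_X hΩ hp, du_sub (by fun_prop) (by fun_prop), du_mul dT dU,
    du_mul (by fun_prop) dX, h.du_dt_T hΩ hp, du_coord_u, h.du_dx_X hΩ hp] at h1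
  linarith

/-- The `x`-derivative of the same equation. -/
theorem dt_dx_X (h : Φ.IsUsualEquivalence Ω) (hΩ : IsOpen Ω) {p : ℝ × ℝ × ℝ} (hp : p ∈ Ω) :
    dt (dx Φ.X) p = dt Φ.T p * dx Φ.U p := by
  have dT := (contDiffAt_dt (h.1.contDiffAt_T hΩ hp)).differentiableAt (by simp)
  have dU := (h.1.contDiffAt_U hΩ hp).differentiableAt (by simp)
  have dX := (contDiffAt_dx (h.1.contDiffAt_X hΩ hp)).differentiableAt (by simp)
  have h1 : dx (dt Φ.X) p = dx (fun p => dt Φ.T p * Φ.U p - p.2.2 * dx Φ.X p) p := by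
    refine dx_congr ?_
    filter_upwards [hΩ.mem_nhds hp] with p' hp' using h.dt_X_eq hΩ hp'
  rw [dx_dt (h.1.contDiffAt_X hΩ hp), dx_sub (by fun_prop) (by fun_prop), dx_mul dT dU,
    dx_mul (by fun_prop) dX, h.dx_dt_T hΩ hp, dx_coord_u, h.dx_dx_X hΩ hp] at h1
  linarith

/-- One more `x`-derivative, applied to `dt_dx_X`: the left side vanishes with `X_xx`, and `T_t` is
not zero. -/
theorem dx_dx_U (h : Φ.IsUsualEquivalence Ω) (hΩ : IsOpen Ω) {p : ℝ × ℝ × ℝ} (hp : p ∈ Ω) :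
    dx (dx Φ.U) p = 0 := by
  have dT := (contDiffAt_dt (h.1.contDiffAt_T hΩ hp)).differentiableAt (by simp)
  have dU := (contDiffAt_dx (h.1.contDiffAt_U hΩ hp)).differentiableAt (by simp)
  have h1 : dx (dt (dx Φ.X)) p = dx (fun p => dt Φ.T p * dx Φ.U p) p := by
    refine dx_congr ?_
    filter_upwards [hΩ.mem_nhds hp] with p' hp' using h.dt_dx_X hΩ hp'
  have h2 : dt (dx (dx Φ.X)) p = 0 := by
    rw [dt_congr (G := fun _ => 0), dt_const]
    filter_upwards [hΩ.mem_nhds hp] with p' hp' using h.dx_dx_X hΩ hp'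
  rw [dx_dt (contDiffAt_dx (h.1.contDiffAt_X hΩ hp)), h2, dx_mul dT dU, h.dx_dt_T hΩ hp,
    zero_mul, zero_add] at h1
  exact (mul_eq_zero.1 h1.symm).resolve_left (h.dt_T_ne_zero hΩ hp)

theorem du_dx_U (h : Φ.IsUsualEquivalence Ω) (hΩ : IsOpen Ω) {p : ℝ × ℝ × ℝ} (hp : p ∈ Ω) :
    du (dx Φ.U) p = 0 := by
  rw [du_dx (h.1.contDiffAt_U hΩ hp), h.dx_du_U hΩ hp]

theorem dt_dx_U (h : Φ.IsUsualEquivalence Ω) (hΩ : IsOpen Ω) {p : ℝ × ℝ × ℝ} (hp : p ∈ Ω) :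
    dt (dx Φ.U) p = 0 := by
  have dU := (contDiffAt_dx (h.1.contDiffAt_U hΩ hp)).differentiableAt (by simp)
  -- Written as a difference from `0` so that `dx_sub` applies.
  have h1 : dx (dt Φ.U) p = dx (fun p => 0 - p.2.2 * dx Φ.U p) p := by
    refine dx_congr ?_
    filter_upwards [hΩ.mem_nhds hp] with p' hp' using by rw [h.dt_U_eq hΩ hp', zero_sub]
  rw [dx_dt (h.1.contDiffAt_U hΩ hp), dx_sub (by fun_prop) (by fun_prop),
    dx_mul (by fun_prop) dU, dx_coord_u, h.dx_dx_U hΩ hp, dx_const] at h1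
  linarith

theorem dt_du_U (h : Φ.IsUsualEquivalence Ω) (hΩ : IsOpen Ω) {p : ℝ × ℝ × ℝ} (hp : p ∈ Ω) :
    dt (du Φ.U) p = -dx Φ.U p := by
  have dU := (contDiffAt_dx (h.1.contDiffAt_U hΩ hp)).differentiableAt (by simp)
  have h1 : du (dt Φ.U) p = du (fun p => 0 - p.2.2 * dx Φ.U p) p := by
    refine du_congr ?_
    filter_upwards [hΩ.mem_nhds hp] with p' hp' using by rw [h.dt_U_eq hΩ hp', zero_sub]
  rw [du_dt (h.1.contDiffAt_U hΩ hp), du_sub (by fun_prop) (by fun_prop),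
    du_mul (by fun_prop) dU, du_coord_u, h.du_dx_U hΩ hp, du_const] at h1
  linarith

/-- Two expressions for `X_xt`, from `dx_X_eq` and `dt_dx_X`. With `U_ut = -U_x` this says that `T_t
U_u^2` does not change with `t`, which makes `T` fractional linear. -/
theorem dt_dt_T_mul (h : Φ.IsUsualEquivalence Ω) (hΩ : IsOpen Ω) {p : ℝ × ℝ × ℝ} (hp : p ∈ Ω) :
    dt (dt Φ.T) p * du Φ.U p = 2 * dt Φ.T p * dx Φ.U p := by
  have dT := (contDiffAt_dt (h.1.contDiffAt_T hΩ hp)).differentiableAt (by simp)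
  have dU := (contDiffAt_du (h.1.contDiffAt_U hΩ hp)).differentiableAt (by simp)
  have h1 : dt (dx Φ.X) p = dt (fun p => dt Φ.T p * du Φ.U p) p := by
    refine dt_congr ?_
    filter_upwards [hΩ.mem_nhds hp] with p' hp' using h.dx_X_eq hΩ hp'
  rw [h.dt_dx_X hΩ hp, dt_mul dT dU, h.dt_du_U hΩ hp] at h1
  linarith

/-- Integration of the determining equations over a connected domain. -/
theorem exists_describes (h : Φ.IsUsualEquivalence Ω) (hΩ : IsOpen Ω) (hconn : IsConnected Ω) :
    ∃ k : Params, k.Describes Φ Ω := by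
  have hc := hconn.isPreconnected
  have dT : ∀ p ∈ Ω, DifferentiableAt ℝ Φ.T p := fun p hp =>
    (h.1.contDiffAt_T hΩ hp).differentiableAt (by simp)
  have dX : ∀ p ∈ Ω, DifferentiableAt ℝ Φ.X p := fun p hp =>
    (h.1.contDiffAt_X hΩ hp).differentiableAt (by simp)
  have dU : ∀ p ∈ Ω, DifferentiableAt ℝ Φ.U p := fun p hp =>
    (h.1.contDiffAt_U hΩ hp).differentiableAt (by simp)
  have dTt : ∀ p ∈ Ω, DifferentiableAt ℝ (dt Φ.T) p := fun p hp =>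
    (contDiffAt_dt (h.1.contDiffAt_T hΩ hp)).differentiableAt (by simp)
  have dUx : ∀ p ∈ Ω, DifferentiableAt ℝ (dx Φ.U) p := fun p hp =>
    (contDiffAt_dx (h.1.contDiffAt_U hΩ hp)).differentiableAt (by simp)
  have dUu : ∀ p ∈ Ω, DifferentiableAt ℝ (du Φ.U) p := fun p hp =>
    (contDiffAt_du (h.1.contDiffAt_U hΩ hp)).differentiableAt (by simp)
  have ct : ∀ p : ℝ × ℝ × ℝ, DifferentiableAt ℝ (fun p : ℝ × ℝ × ℝ => p.1) p := fun p => by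
    fun_prop
  have cx : ∀ p : ℝ × ℝ × ℝ, DifferentiableAt ℝ (fun p : ℝ × ℝ × ℝ => p.2.1) p := fun p => by
    fun_prop
  have cu : ∀ p : ℝ × ℝ × ℝ, DifferentiableAt ℝ (fun p : ℝ × ℝ × ℝ => p.2.2) p := fun p => by
    fun_prop
  have cc : ∀ (a : ℝ) (p : ℝ × ℝ × ℝ), DifferentiableAt ℝ (fun _ : ℝ × ℝ × ℝ => a) p :=
    fun a p => by fun_prop
  -- `κ = U_x` will be `-c`, and next `U_u = d - κ t` becomes the denominator `ct + d`.
  obtain ⟨κ, hκ⟩ := exists_eq_const_of_partials hΩ hc dUx fun p hp =>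
    ⟨h.dt_dx_U hΩ hp, h.dx_dx_U hΩ hp, h.du_dx_U hΩ hp⟩
  obtain ⟨d, hd⟩ := exists_eq_const_of_partials (F := fun p => du Φ.U p + κ * p.1) hΩ hc
    (fun p hp => (dUu p hp).fun_add ((cc κ p).fun_mul (ct p))) fun p hp => by
      rw [dt_add (dUu p hp) ((cc κ p).fun_mul (ct p)), dx_add (dUu p hp) ((cc κ p).fun_mul (ct p)),
        du_add (dUu p hp) ((cc κ p).fun_mul (ct p)), dt_mul (cc κ p) (ct p), dx_mul (cc κ p) (ct p),
        du_mul (cc κ p) (ct p), dt_const, dx_const, du_const, dt_coord_t, dx_coord_t, du_coord_t,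
        h.dt_du_U hΩ hp, h.dx_du_U hΩ hp, h.du_du_U hΩ hp, hκ p hp]
      refine ⟨?_, ?_, ?_⟩ <;> ring
  obtain ⟨μ, hμ⟩ := exists_eq_const_of_partials
    (F := fun p => Φ.U p - κ * p.2.1 - du Φ.U p * p.2.2) hΩ hc
    (fun p hp => ((dU p hp).fun_sub ((cc κ p).fun_mul (cx p))).fun_sub ((dUu p hp).fun_mul (cu p))) fun p hp => by
      have e1 := (dU p hp).fun_sub ((cc κ p).fun_mul (cx p))
      have e2 := (dUu p hp).fun_mul (cu p)
      rw [dt_sub e1 e2, dx_sub e1 e2, du_sub e1 e2,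
        dt_sub (dU p hp) ((cc κ p).fun_mul (cx p)), dx_sub (dU p hp) ((cc κ p).fun_mul (cx p)),
        du_sub (dU p hp) ((cc κ p).fun_mul (cx p)), dt_mul (cc κ p) (cx p), dx_mul (cc κ p) (cx p),
        du_mul (cc κ p) (cx p), dt_mul (dUu p hp) (cu p), dx_mul (dUu p hp) (cu p),
        du_mul (dUu p hp) (cu p), dt_const, dx_const, du_const, dt_coord_x, dx_coord_x, du_coord_x,
        dt_coord_u, dx_coord_u, du_coord_u, h.dt_du_U hΩ hp, h.dx_du_U hΩ hp, h.du_du_U hΩ hp,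
        h.dt_U_eq hΩ hp, hκ p hp]
      refine ⟨?_, ?_, ?_⟩ <;> ring
  -- This expression is `(T U_u)_t`; once it is constant, `T U_u = a t + b`.
  obtain ⟨a, ha⟩ := exists_eq_const_of_partials
    (F := fun p => dt Φ.T p * du Φ.U p - κ * Φ.T p) hΩ hc
    (fun p hp => ((dTt p hp).fun_mul (dUu p hp)).fun_sub ((cc κ p).fun_mul (dT p hp))) fun p hp => by
      have e1 := (dTt p hp).fun_mul (dUu p hp)
      have e2 := (cc κ p).fun_mul (dT p hp)
      have e3 := h.dt_dt_T_mul hΩ hp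
      rw [dt_sub e1 e2, dx_sub e1 e2, du_sub e1 e2, dt_mul (dTt p hp) (dUu p hp),
        dx_mul (dTt p hp) (dUu p hp), du_mul (dTt p hp) (dUu p hp), dt_mul (cc κ p) (dT p hp),
        dx_mul (cc κ p) (dT p hp), du_mul (cc κ p) (dT p hp), dt_const, dx_const, du_const,
        h.dt_du_U hΩ hp, h.dx_du_U hΩ hp, h.du_du_U hΩ hp, h.dx_dt_T hΩ hp, h.du_dt_T hΩ hp,
        h.dx_T hΩ hp, h.du_T hΩ hp, e3, hκ p hp]
      refine ⟨?_, ?_, ?_⟩ <;> ring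
  obtain ⟨b, hb⟩ := exists_eq_const_of_partials
    (F := fun p => Φ.T p * du Φ.U p - a * p.1) hΩ hc
    (fun p hp => ((dT p hp).fun_mul (dUu p hp)).fun_sub ((cc a p).fun_mul (ct p))) fun p hp => by
      have e1 := (dT p hp).fun_mul (dUu p hp)
      have e2 := (cc a p).fun_mul (ct p)
      have e3 := ha p hp
      rw [dt_sub e1 e2, dx_sub e1 e2, du_sub e1 e2, dt_mul (dT p hp) (dUu p hp),
        dx_mul (dT p hp) (dUu p hp), du_mul (dT p hp) (dUu p hp), dt_mul (cc a p) (ct p),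
        dx_mul (cc a p) (ct p), du_mul (cc a p) (ct p), dt_const, dx_const, du_const,
        dt_coord_t, dx_coord_t, du_coord_t,
        h.dt_du_U hΩ hp, h.dx_du_U hΩ hp, h.du_du_U hΩ hp,
        h.dx_T hΩ hp, h.du_T hΩ hp, hκ p hp]
      refine ⟨?_, ?_, ?_⟩ <;> linarith
  -- With `U = κ x + U_u u + μ`, the equation for `X_t` integrates to `X = X_x x + μ T + ν`, where
  -- `X_x = T_t U_u`.
  obtain ⟨ν, hν⟩ := exists_eq_const_of_partials
    (F := fun p => Φ.X p - μ * Φ.T p - dt Φ.T p * du Φ.U p * p.2.1) hΩ hc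
    (fun p hp => ((dX p hp).fun_sub ((cc μ p).fun_mul (dT p hp))).fun_sub
      (((dTt p hp).fun_mul (dUu p hp)).fun_mul (cx p))) fun p hp => by
      have e0 := (cc μ p).fun_mul (dT p hp)
      have e1 := (dX p hp).fun_sub e0
      have e2 := (dTt p hp).fun_mul (dUu p hp)
      have e3 := e2.fun_mul (cx p)
      have e4 := hμ p hp
      have e5 := h.dt_dt_T_mul hΩ hp
      rw [dt_sub e1 e3, dx_sub e1 e3, du_sub e1 e3, dt_sub (dX p hp) e0, dx_sub (dX p hp) e0,
        du_sub (dX p hp) e0, dt_mul (cc μ p) (dT p hp), dx_mul (cc μ p) (dT p hp),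
        du_mul (cc μ p) (dT p hp), dt_mul e2 (cx p), dx_mul e2 (cx p), du_mul e2 (cx p),
        dt_mul (dTt p hp) (dUu p hp),
        dx_mul (dTt p hp) (dUu p hp), du_mul (dTt p hp) (dUu p hp), dt_const, dx_const, du_const,
        dt_coord_x, dx_coord_x, du_coord_x,
        h.dt_du_U hΩ hp, h.dx_du_U hΩ hp, h.du_du_U hΩ hp, h.dx_dt_T hΩ hp, h.du_dt_T hΩ hp,
        h.dx_T hΩ hp, h.du_T hΩ hp, h.dt_X_eq hΩ hp, h.dx_X_eq hΩ hp, h.du_X hΩ hp, e5, hκ p hp]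
      refine ⟨?_, ?_, ?_⟩
      · linear_combination dt Φ.T p * e4
      · ring
      · ring
  have hM : ∀ p ∈ Ω, a * d - b * -κ = dt Φ.T p * du Φ.U p ^ 2 := fun p hp => by
    linear_combination -a * hd p hp - κ * hb p hp - du Φ.U p * ha p hp
  have hM0 : a * d - b * -κ ≠ 0 := by
    obtain ⟨p, hp⟩ := hconn.nonempty
    rw [hM p hp]
    exact mul_ne_zero (h.dt_T_ne_zero hΩ hp) (pow_ne_zero 2 (h.du_U_ne_zero hΩ hp))
  -- The free multiplier is fixed by `U_u = ct + d`, which amounts to `e₂ = Δ`. The values of `e₀`,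
  -- `e₁` come from `e₁ t + e₀ = μ (at + b) + ν (ct + d)`.
  refine ⟨⟨a, b, -κ, d, μ * b + ν * d, μ * a + ν * -κ, a * d - b * -κ⟩, hM0, hM0, ?_⟩
  intro t x u hp
  have hs : -κ * t + d = du Φ.U (t, x, u) := by have := hd _ hp; simp only at this; linarith
  have hs0 := h.du_U_ne_zero hΩ hp
  have hT0 := h.dt_T_ne_zero hΩ hp
  have h1 := hM _ hp
  have h2 := hμ _ hp
  have h3 := hb _ hp
  have h4 := hν _ hp
  simp only at h2 h3 h4
  simp only [Params.Δ, hs]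
  refine ⟨hs0, ?_, ?_, ?_, fun β σ hβ hσ => ⟨?_, ?_⟩⟩
  · rw [eq_div_iff hs0]; linarith
  · rw [eq_div_iff hs0, h1]
    linear_combination du Φ.U (t, x, u) * h4 + μ * h3 - ν * hs
  · rw [eq_div_iff hM0]
    linear_combination (a * d - b * -κ) * h2
  · have h5 := h.B_eq hΩ hp hβ hσ
    rw [h.dx_X_eq hΩ hp] at h5
    rw [h1]
    refine mul_left_cancel₀ hT0 (h5.trans ?_)
    field_simp
  · have h5 := h.S_eq hΩ hp hβ hσ
    rw [h.dx_X_eq hΩ hp] at h5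
    rw [h1]
    refine mul_left_cancel₀ hT0 (h5.trans ?_)
    field_simp

end Integration

end IsUsualEquivalence

end Transformation

section Partials

variable {F : ℝ × ℝ × ℝ → ℝ} {t x u m : ℝ}

theorem dt_eq_of_hasDerivAt (hF : DifferentiableAt ℝ F (t, x, u))
    (h : HasDerivAt (fun s => F (s, x, u)) m t) : dt F (t, x, u) = m :=
  (HasFDerivAt.comp_hasDerivAt (f := fun s : ℝ => (s, x, u)) t hF.hasFDerivAt
    ((hasDerivAt_id t).prodMk (hasDerivAt_const t (x, u)))).unique h

theorem dx_eq_of_hasDerivAt (hF : DifferentiableAt ℝ F (t, x, u))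
    (h : HasDerivAt (fun s => F (t, s, u)) m x) : dx F (t, x, u) = m :=
  (HasFDerivAt.comp_hasDerivAt (f := fun s : ℝ => (t, s, u)) x hF.hasFDerivAt
    ((hasDerivAt_const x t).prodMk ((hasDerivAt_id x).prodMk (hasDerivAt_const x u)))).unique h

theorem du_eq_of_hasDerivAt (hF : DifferentiableAt ℝ F (t, x, u))
    (h : HasDerivAt (fun s => F (t, x, s)) m u) : du F (t, x, u) = m :=
  (HasFDerivAt.comp_hasDerivAt (f := fun s : ℝ => (t, x, s)) u hF.hasFDerivAt
    ((hasDerivAt_const u t).prodMk ((hasDerivAt_const u x).prodMk (hasDerivAt_id u)))).unique h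

end Partials

theorem hasDerivAt_affine (m n y : ℝ) : HasDerivAt (fun s => m * s + n) m y := by
  simpa using ((hasDerivAt_id y).const_mul m).add_const n

namespace Params

variable {k k' : Params} {Φ : Transformation} {Ω : Set (ℝ × ℝ × ℝ)}

/-! ### Smoothness and partials of the explicit formulas. -/

section Formulas

theorem Describes.eventually_T (h : k.Describes Φ Ω) (hΩ : IsOpen Ω) {p : ℝ × ℝ × ℝ}
    (hp : p ∈ Ω) : Φ.T =ᶠ[𝓝 p] fun p => (k.a * p.1 + k.b) / (k.c * p.1 + k.d) := by
  filter_upwards [hΩ.mem_nhds hp] with p' hp' using (h.2.2 p'.1 p'.2.1 p'.2.2 hp').2.1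

theorem Describes.eventually_X (h : k.Describes Φ Ω) (hΩ : IsOpen Ω) {p : ℝ × ℝ × ℝ}
    (hp : p ∈ Ω) :
    Φ.X =ᶠ[𝓝 p] fun p => (k.e₂ * p.2.1 + k.e₁ * p.1 + k.e₀) / (k.c * p.1 + k.d) := by
  filter_upwards [hΩ.mem_nhds hp] with p' hp' using (h.2.2 p'.1 p'.2.1 p'.2.2 hp').2.2.1

theorem Describes.eventually_U (h : k.Describes Φ Ω) (hΩ : IsOpen Ω) {p : ℝ × ℝ × ℝ}
    (hp : p ∈ Ω) :
    Φ.U =ᶠ[𝓝 p] fun p => (k.e₂ * (k.c * p.1 + k.d) * p.2.2 - k.e₂ * k.c * p.2.1 - k.e₀ * k.c +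
      k.e₁ * k.d) / k.Δ := by
  filter_upwards [hΩ.mem_nhds hp] with p' hp' using (h.2.2 p'.1 p'.2.1 p'.2.2 hp').2.2.2.1

theorem Describes.eventually_B (h : k.Describes Φ Ω) (hΩ : IsOpen Ω)
    {q : (ℝ × ℝ × ℝ) × ℝ × ℝ} (hq : q ∈ Transformation.extendedDomain Ω) :
    Φ.B =ᶠ[𝓝 q] fun q => k.e₂ ^ 3 / (k.c * q.1.1 + k.d) * (q.2.1 / k.Δ) := by
  filter_upwards [(Transformation.isOpen_extendedDomain hΩ).mem_nhds hq] with q' hq' using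
    ((h.2.2 q'.1.1 q'.1.2.1 q'.1.2.2 hq'.1).2.2.2.2 _ _ hq'.2.1 hq'.2.2).1

theorem Describes.eventually_S (h : k.Describes Φ Ω) (hΩ : IsOpen Ω)
    {q : (ℝ × ℝ × ℝ) × ℝ × ℝ} (hq : q ∈ Transformation.extendedDomain Ω) :
    Φ.S =ᶠ[𝓝 q] fun q => k.e₂ ^ 5 / (k.c * q.1.1 + k.d) ^ 3 * (q.2.2 / k.Δ) := by
  filter_upwards [(Transformation.isOpen_extendedDomain hΩ).mem_nhds hq] with q' hq' using
    ((h.2.2 q'.1.1 q'.1.2.1 q'.1.2.2 hq'.1).2.2.2.2 _ _ hq'.2.1 hq'.2.2).2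

theorem Describes.contDiffAt_T (h : k.Describes Φ Ω) (hΩ : IsOpen Ω) {p : ℝ × ℝ × ℝ}
    (hp : p ∈ Ω) : ContDiffAt ℝ ∞ Φ.T p :=
  ContDiffAt.congr_of_eventuallyEq
    (ContDiffAt.fun_div (by fun_prop) (by fun_prop) (h.2.2 p.1 p.2.1 p.2.2 hp).1)
    (h.eventually_T hΩ hp)

theorem Describes.contDiffAt_X (h : k.Describes Φ Ω) (hΩ : IsOpen Ω) {p : ℝ × ℝ × ℝ}
    (hp : p ∈ Ω) : ContDiffAt ℝ ∞ Φ.X p :=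
  ContDiffAt.congr_of_eventuallyEq
    (ContDiffAt.fun_div (by fun_prop) (by fun_prop) (h.2.2 p.1 p.2.1 p.2.2 hp).1)
    (h.eventually_X hΩ hp)

theorem Describes.contDiffAt_U (h : k.Describes Φ Ω) (hΩ : IsOpen Ω) {p : ℝ × ℝ × ℝ}
    (hp : p ∈ Ω) : ContDiffAt ℝ ∞ Φ.U p :=
  ContDiffAt.congr_of_eventuallyEq (by fun_prop) (h.eventually_U hΩ hp)

theorem Describes.contDiffAt_B (h : k.Describes Φ Ω) (hΩ : IsOpen Ω)
    {q : (ℝ × ℝ × ℝ) × ℝ × ℝ} (hq : q ∈ Transformation.extendedDomain Ω) :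
    ContDiffAt ℝ ∞ Φ.B q :=
  ContDiffAt.congr_of_eventuallyEq (ContDiffAt.mul (ContDiffAt.fun_div (by fun_prop) (by fun_prop)
    (h.2.2 _ _ _ hq.1).1) (by fun_prop)) (h.eventually_B hΩ hq)

theorem Describes.contDiffAt_S (h : k.Describes Φ Ω) (hΩ : IsOpen Ω)
    {q : (ℝ × ℝ × ℝ) × ℝ × ℝ} (hq : q ∈ Transformation.extendedDomain Ω) :
    ContDiffAt ℝ ∞ Φ.S q :=
  ContDiffAt.congr_of_eventuallyEq (ContDiffAt.mul (ContDiffAt.fun_div (by fun_prop) (by fun_prop)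
    (pow_ne_zero 3 (h.2.2 _ _ _ hq.1).1)) (by fun_prop)) (h.eventually_S hΩ hq)

theorem Describes.partials_T (h : k.Describes Φ Ω) (hΩ : IsOpen Ω) {t x u : ℝ}
    (hp : (t, x, u) ∈ Ω) : dt Φ.T (t, x, u) = k.Δ / (k.c * t + k.d) ^ 2 ∧
      dx Φ.T (t, x, u) = 0 ∧ du Φ.T (t, x, u) = 0 := by
  have he := h.eventually_T hΩ hp
  have hd := (h.contDiffAt_T hΩ hp).congr_of_eventuallyEq he.symm |>.differentiableAt (by simp)
  have hs := (h.2.2 _ _ _ hp).1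
  rw [dt_congr he, dx_congr he, du_congr he]
  refine ⟨dt_eq_of_hasDerivAt hd ?_, dx_eq_of_hasDerivAt hd
    (hasDerivAt_const x ((k.a * t + k.b) / (k.c * t + k.d))),
    du_eq_of_hasDerivAt hd (hasDerivAt_const u ((k.a * t + k.b) / (k.c * t + k.d)))⟩
  refine ((hasDerivAt_affine k.a k.b t).fun_div (hasDerivAt_affine k.c k.d t) hs).congr_deriv ?_
  rw [Δ]; ring

theorem Describes.partials_X (h : k.Describes Φ Ω) (hΩ : IsOpen Ω) {t x u : ℝ}
    (hp : (t, x, u) ∈ Ω) :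
    dt Φ.X (t, x, u) = (k.e₁ * (k.c * t + k.d) - k.c * (k.e₂ * x + k.e₁ * t + k.e₀)) /
      (k.c * t + k.d) ^ 2 ∧
      dx Φ.X (t, x, u) = k.e₂ / (k.c * t + k.d) ∧ du Φ.X (t, x, u) = 0 := by
  have he := h.eventually_X hΩ hp
  have hd := (h.contDiffAt_X hΩ hp).congr_of_eventuallyEq he.symm |>.differentiableAt (by simp)
  have hs := (h.2.2 _ _ _ hp).1
  rw [dt_congr he, dx_congr he, du_congr he]
  refine ⟨dt_eq_of_hasDerivAt hd ?_, dx_eq_of_hasDerivAt hd ?_,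
    du_eq_of_hasDerivAt hd
      (hasDerivAt_const u ((k.e₂ * x + k.e₁ * t + k.e₀) / (k.c * t + k.d)))⟩
  · have h1 := (hasDerivAt_affine k.e₁ (k.e₂ * x + k.e₀) t).fun_div
      (hasDerivAt_affine k.c k.d t) hs
    refine (h1.congr_deriv (f' := _) ?_).congr_of_eventuallyEq (Eventually.of_forall fun s => ?_)
    · ring
    · simp only; ring
  · have h1 := (hasDerivAt_affine k.e₂ (k.e₁ * t + k.e₀) x).div_const (k.c * t + k.d)
    refine h1.congr_of_eventuallyEq (Eventually.of_forall fun s => ?_)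
    simp only; ring

theorem Describes.partials_U (h : k.Describes Φ Ω) (hΩ : IsOpen Ω) {t x u : ℝ}
    (hp : (t, x, u) ∈ Ω) : dt Φ.U (t, x, u) = k.e₂ * k.c * u / k.Δ ∧
      dx Φ.U (t, x, u) = -(k.e₂ * k.c) / k.Δ ∧
      du Φ.U (t, x, u) = k.e₂ * (k.c * t + k.d) / k.Δ := by
  have he := h.eventually_U hΩ hp
  have hd := (h.contDiffAt_U hΩ hp).congr_of_eventuallyEq he.symm |>.differentiableAt (by simp)
  rw [dt_congr he, dx_congr he, du_congr he]
  refine ⟨dt_eq_of_hasDerivAt hd ?_, dx_eq_of_hasDerivAt hd ?_, du_eq_of_hasDerivAt hd ?_⟩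
  · refine ((hasDerivAt_affine (k.e₂ * k.c * u) (k.e₂ * k.d * u - k.e₂ * k.c * x - k.e₀ * k.c +
      k.e₁ * k.d) t).div_const k.Δ).congr_of_eventuallyEq (Eventually.of_forall fun s => ?_)
    simp only; ring
  · refine ((hasDerivAt_affine (-(k.e₂ * k.c)) (k.e₂ * (k.c * t + k.d) * u - k.e₀ * k.c +
      k.e₁ * k.d) x).div_const k.Δ).congr_of_eventuallyEq (Eventually.of_forall fun s => ?_)
    simp only; ring
  · refine ((hasDerivAt_affine (k.e₂ * (k.c * t + k.d)) (-(k.e₂ * k.c * x) - k.e₀ * k.c +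
      k.e₁ * k.d) u).div_const k.Δ).congr_of_eventuallyEq (Eventually.of_forall fun s => ?_)
    simp only; ring

end Formulas

/-! ### Uniqueness and normalization of the tuple. -/

section Uniqueness

theorem Δ_scale (m : ℝ) (k : Params) : (scale m k).Δ = m ^ 2 * k.Δ := by
  simp only [Δ, scale]; ring

/-- All five expressions are homogeneous of degree zero in the tuple, `Δ` being quadratic. -/
theorem Describes.scale (h : k.Describes Φ Ω) {m : ℝ} (hm : m ≠ 0) :
    (scale m k).Describes Φ Ω := by
  obtain ⟨hΔ, he, h⟩ := h
  refine ⟨by rw [Δ_scale]; exact mul_ne_zero (pow_ne_zero 2 hm) hΔ, mul_ne_zero hm he,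
    fun t x u hp => ?_⟩
  obtain ⟨hs, hT, hX, hU, hBS⟩ := h t x u hp
  have hs' : (Params.scale m k).c * t + (Params.scale m k).d = m * (k.c * t + k.d) := by
    simp only [Params.scale]; ring
  rw [hs', Δ_scale, hT, hX, hU]
  refine ⟨mul_ne_zero hm hs, ?_, ?_, ?_, fun β σ hβ hσ => ?_⟩
  · rw [div_eq_div_iff hs (mul_ne_zero hm hs)]
    simp only [Params.scale]; ring
  · rw [div_eq_div_iff hs (mul_ne_zero hm hs)]
    simp only [Params.scale]; ring
  · rw [div_eq_div_iff hΔ (mul_ne_zero (pow_ne_zero 2 hm) hΔ)]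
    simp only [Params.scale]; ring
  · rw [(hBS β σ hβ hσ).1, (hBS β σ hβ hσ).2]
    simp only [Params.scale]
    constructor
    · field_simp
    · field_simp

/-- One point suffices. With `r` the ratio of the `e₂`, the derivative `X_x` fixes `ct + d`, `T_t`
fixes `Δ`, `U_x` fixes `c`, and the values of `T`, `X`, `U` determine the rest. -/
theorem Describes.eq_scale (h : k.Describes Φ Ω) (h' : k'.Describes Φ Ω) (hΩ : IsOpen Ω)
    (hne : Ω.Nonempty) : ∃ m : ℝ, m ≠ 0 ∧ k' = Params.scale m k := by
  obtain ⟨⟨t, x, u⟩, hp⟩ := hne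
  obtain ⟨hTt, -, -⟩ := h.partials_T hΩ hp
  obtain ⟨hTt', -, -⟩ := h'.partials_T hΩ hp
  obtain ⟨-, hXx, -⟩ := h.partials_X hΩ hp
  obtain ⟨-, hXx', -⟩ := h'.partials_X hΩ hp
  obtain ⟨-, hUx, hUu⟩ := h.partials_U hΩ hp
  obtain ⟨-, hUx', hUu'⟩ := h'.partials_U hΩ hp
  obtain ⟨hΔ, he, h⟩ := h
  obtain ⟨hΔ', he', h'⟩ := h'
  obtain ⟨hs, hT, hX, hU, -⟩ := h t x u hp
  obtain ⟨hs', hT', hX', hU', -⟩ := h' t x u hp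
  rw [hTt'] at hTt
  rw [hXx'] at hXx
  rw [hUx'] at hUx
  rw [hUu'] at hUu
  rw [hT'] at hT
  rw [hX'] at hX
  rw [hU'] at hU
  obtain ⟨r, hr⟩ : ∃ r, r = k'.e₂ / k.e₂ := ⟨_, rfl⟩
  have hr0 : r ≠ 0 := by rw [hr]; exact div_ne_zero he' he
  have re : k'.e₂ = r * k.e₂ := by rw [hr]; field_simp
  have rs : k'.c * t + k'.d = r * (k.c * t + k.d) := by
    rw [div_eq_div_iff hs' hs, re] at hXx
    exact mul_left_cancel₀ he (by linear_combination -hXx)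
  have rΔ : k'.Δ = r ^ 2 * k.Δ := by
    rw [rs, div_eq_div_iff (pow_ne_zero 2 (mul_ne_zero hr0 hs)) (pow_ne_zero 2 hs)] at hTt
    exact mul_left_cancel₀ (pow_ne_zero 2 hs) (by linear_combination hTt)
  have rc : k'.c = r * k.c := by
    rw [div_eq_div_iff hΔ' hΔ, re, rΔ] at hUx
    exact mul_left_cancel₀ (mul_ne_zero (mul_ne_zero hr0 he) hΔ) (by linear_combination -hUx)
  have rd : k'.d = r * k.d := by linear_combination rs - t * rc
  have rab : k'.a * t + k'.b = r * (k.a * t + k.b) := by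
    rw [rs, div_eq_div_iff (mul_ne_zero hr0 hs) hs] at hT
    exact mul_left_cancel₀ hs (by linear_combination hT)
  -- Uses `Δ = a (ct + d) - c (at + b)`.
  have ra : k'.a = r * k.a := by
    have h1 := rΔ
    simp only [Δ, rc, rd] at h1
    refine mul_left_cancel₀ (mul_ne_zero hr0 hs) ?_
    linear_combination h1 + r * k.c * rab
  have rb : k'.b = r * k.b := by linear_combination rab - t * ra
  have re10 : k'.e₁ * t + k'.e₀ = r * (k.e₁ * t + k.e₀) := by
    rw [rs, re, div_eq_div_iff (mul_ne_zero hr0 hs) hs] at hX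
    exact mul_left_cancel₀ hs (by linear_combination hX)
  -- Uses `e₁ d - e₀ c = e₁ (ct + d) - c (e₁ t + e₀)`, the combination that occurs in `U`.
  have re1 : k'.e₁ = r * k.e₁ := by
    rw [rs, re, rc, rd, rΔ, div_eq_div_iff (mul_ne_zero (pow_ne_zero 2 hr0) hΔ) hΔ] at hU
    refine mul_left_cancel₀ (mul_ne_zero hr0 hs) (mul_left_cancel₀ hΔ ?_)
    linear_combination hU + r * k.c * k.Δ * re10
  have re0 : k'.e₀ = r * k.e₀ := by linear_combination re10 - t * re1
  refine ⟨r, hr0, ?_⟩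
  cases k'
  simp only at ra rb rc rd re0 re1 re
  simp only [Params.scale, ra, rb, rc, rd, re0, re1, re]

/-- A multiplier `m` changes `Δ` by `m^2`, so its absolute value can be made 1 while its sign
persists. -/
theorem Describes.exists_normalized (h : k.Describes Φ Ω) :
    ∃ k' : Params, (k'.Δ = 1 ∨ k'.Δ = -1) ∧ k'.Describes Φ Ω := by
  have hpos : 0 < |k.Δ| := abs_pos.2 h.1
  refine ⟨Params.scale (√|k.Δ|)⁻¹ k, ?_, h.scale (inv_ne_zero (Real.sqrt_ne_zero'.2 hpos))⟩
  rw [Δ_scale, inv_pow, Real.sq_sqrt hpos.le]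
  rcases lt_or_gt_of_ne h.1 with h0 | h0
  · right; rw [abs_of_neg h0]; field_simp [h.1]
  · left; rw [abs_of_pos h0]; field_simp [h.1]

end Uniqueness

/-! ### The formulas define equivalence transformations. -/

section Equivalence

/-- In the order `t`, `x`, `u`, `(β, σ)` the differential is triangular with nonzero diagonal;
injectivity suffices by dimension. -/
theorem Describes.isNondegenerate (h : k.Describes Φ Ω) (hΩ : IsOpen Ω) :
    Φ.IsNondegenerate Ω := by
  refine ⟨fun q hq => ?_, fun q hq => ?_⟩
  · have h1 : ContDiffAt ℝ ∞ (fun q : (ℝ × ℝ × ℝ) × ℝ × ℝ => (Φ.T q.1, Φ.X q.1, Φ.U q.1)) q :=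
      ((h.contDiffAt_T hΩ hq.1).comp q contDiffAt_fst).prodMk
        (((h.contDiffAt_X hΩ hq.1).comp q contDiffAt_fst).prodMk
          ((h.contDiffAt_U hΩ hq.1).comp q contDiffAt_fst))
    exact (h1.prodMk ((h.contDiffAt_B hΩ hq).prodMk (h.contDiffAt_S hΩ hq))).contDiffWithinAt
  · have dB := (h.contDiffAt_B hΩ hq).differentiableAt (n := ∞) (by simp)
    have dS := (h.contDiffAt_S hΩ hq).differentiableAt (n := ∞) (by simp)
    have hd := Transformation.hasFDerivAt_toMap
      ((h.contDiffAt_T hΩ hq.1).differentiableAt (by simp))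
      ((h.contDiffAt_X hΩ hq.1).differentiableAt (by simp))
      ((h.contDiffAt_U hΩ hq.1).differentiableAt (by simp)) dB dS
    have hinj : Function.Injective (fderiv ℝ Φ.toMap q) := by
      refine (injective_iff_map_eq_zero _).2 ?_
      obtain ⟨⟨t, x, u⟩, β, σ⟩ := q
      obtain ⟨hTt, hTx, hTu⟩ := h.partials_T hΩ hq.1
      obtain ⟨hXt, hXx, hXu⟩ := h.partials_X hΩ hq.1
      obtain ⟨hUt, hUx, hUu⟩ := h.partials_U hΩ hq.1
      have hs : k.c * t + k.d ≠ 0 := (h.2.2 _ _ _ hq.1).1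
      rintro ⟨⟨t', x', u'⟩, β', σ'⟩ hw
      rw [hd.fderiv] at hw
      simp only [ContinuousLinearMap.prod_apply, ContinuousLinearMap.comp_apply,
        ContinuousLinearMap.coe_fst', fderiv_eq_partials, Prod.mk_eq_zero] at hw
      obtain ⟨⟨hT, hX, hU⟩, hB, hS⟩ := hw
      rw [hTt, hTx, hTu, mul_zero, mul_zero, add_zero, add_zero] at hT
      have ht : t' = 0 := (mul_eq_zero.1 hT).resolve_right (div_ne_zero h.1 (pow_ne_zero 2 hs))
      rw [ht, hXx, hXu, zero_mul, zero_add, mul_zero, add_zero] at hX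
      have hx : x' = 0 := (mul_eq_zero.1 hX).resolve_right (div_ne_zero h.2.1 hs)
      rw [ht, hx, hUu, zero_mul, zero_mul, zero_add, zero_add] at hU
      have hu : u' = 0 :=
        (mul_eq_zero.1 hU).resolve_right (div_ne_zero (mul_ne_zero h.2.1 hs) h.1)
      subst ht hx hu
      -- Only a direction in the `(β, σ)`-plane is left. `B` and `S` are linear there, so their
      -- derivatives are read off along a line.
      have hline : HasDerivAt (fun r : ℝ => (((t, x, u), β + r * β', σ + r * σ') :
          (ℝ × ℝ × ℝ) × ℝ × ℝ)) ((0, 0, 0), β', σ') 0 := by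
        have hl : ∀ y y' : ℝ, HasDerivAt (fun r : ℝ => y + r * y') y' 0 := fun y y' => by
          simpa using ((hasDerivAt_id (0 : ℝ)).mul_const y').const_add y
        exact (hasDerivAt_const _ _).prodMk ((hl _ _).prodMk (hl _ _))
      have h0 : (((t, x, u), β + 0 * β', σ + 0 * σ') : (ℝ × ℝ × ℝ) × ℝ × ℝ) =
          ((t, x, u), β, σ) := by simp
      have hmem : ∀ {f g : (ℝ × ℝ × ℝ) × ℝ × ℝ → ℝ}, f =ᶠ[𝓝 ((t, x, u), β, σ)] g →
          (fun r : ℝ => f ((t, x, u), β + r * β', σ + r * σ')) =ᶠ[𝓝 0]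
            fun r : ℝ => g ((t, x, u), β + r * β', σ + r * σ') := by
        intro f g hfg
        have h2 := hline.continuousAt.tendsto
        simp only [zero_mul, add_zero] at h2
        exact h2.eventually hfg
      have hB1 := HasFDerivAt.comp_hasDerivAt (f := fun r : ℝ => (((t, x, u), β + r * β',
        σ + r * σ') : (ℝ × ℝ × ℝ) × ℝ × ℝ)) (0 : ℝ) (by rw [h0]; exact dB.hasFDerivAt) hline
      have hS1 := HasFDerivAt.comp_hasDerivAt (f := fun r : ℝ => (((t, x, u), β + r * β',
        σ + r * σ') : (ℝ × ℝ × ℝ) × ℝ × ℝ)) (0 : ℝ) (by rw [h0]; exact dS.hasFDerivAt) hline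
      have hB2 := (hB1.congr_of_eventuallyEq (hmem (h.eventually_B hΩ hq)).symm).unique
        ((hasDerivAt_affine (k.e₂ ^ 3 / (k.c * t + k.d) * (β' / k.Δ))
          (k.e₂ ^ 3 / (k.c * t + k.d) * (β / k.Δ)) 0).congr_of_eventuallyEq
            (Eventually.of_forall fun r => by simp only; ring))
      have hS2 := (hS1.congr_of_eventuallyEq (hmem (h.eventually_S hΩ hq)).symm).unique
        ((hasDerivAt_affine (k.e₂ ^ 5 / (k.c * t + k.d) ^ 3 * (σ' / k.Δ))
          (k.e₂ ^ 5 / (k.c * t + k.d) ^ 3 * (σ / k.Δ)) 0).congr_of_eventuallyEq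
            (Eventually.of_forall fun r => by simp only; ring))
      rw [hB2] at hB
      rw [hS2] at hS
      have hβ : β' = 0 := by simpa [h.2.1, hs, h.1] using hB
      have hσ : σ' = 0 := by simpa [h.2.1, hs, h.1] using hS
      simp [hβ, hσ]
    exact ⟨hinj, (LinearMap.injective_iff_surjective (f := (fderiv ℝ Φ.toMap q :
      (ℝ × ℝ × ℝ) × ℝ × ℝ →ₗ[ℝ] (ℝ × ℝ × ℝ) × ℝ × ℝ))).1 hinj⟩

/-- The transformed equation, over the image of an interval. -/
theorem exists_image_equation (hΔ : k.Δ ≠ 0) (he : k.e₂ ≠ 0) (E : Equation) {J : Set ℝ}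
    (hJ : IsOpen J) (hJc : IsPreconnected J) (hJn : J.Nonempty) (hJE : J ⊆ E.I)
    (hs : ∀ t ∈ J, k.c * t + k.d ≠ 0) :
    ∃ E' : Equation, ∀ t ∈ J, (k.a * t + k.b) / (k.c * t + k.d) ∈ E'.I ∧
      E'.β ((k.a * t + k.b) / (k.c * t + k.d)) = k.e₂ ^ 3 / (k.c * t + k.d) * (E.β t / k.Δ) ∧
      E'.σ ((k.a * t + k.b) / (k.c * t + k.d)) =
        k.e₂ ^ 5 / (k.c * t + k.d) ^ 3 * (E.σ t / k.Δ) := by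
  set τ : ℝ → ℝ := fun t => (k.a * t + k.b) / (k.c * t + k.d) with hτ
  set ρ : ℝ → ℝ := fun s => (k.d * s - k.b) / (k.a - k.c * s) with hρ
  have hden : ∀ t ∈ J, k.a - k.c * τ t = k.Δ / (k.c * t + k.d) := fun t ht => by
    have := hs t ht
    simp only [hτ, Δ]; field_simp; ring
  have hden0 : ∀ t ∈ J, k.a - k.c * τ t ≠ 0 := fun t ht => by
    rw [hden t ht]; exact div_ne_zero hΔ (hs t ht)
  have hρτ : ∀ t ∈ J, ρ (τ t) = t := fun t ht => by
    have h1 := hs t ht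
    have h2 : τ t * (k.c * t + k.d) = k.a * t + k.b := div_mul_cancel₀ _ h1
    change (k.d * τ t - k.b) / (k.a - k.c * τ t) = t
    rw [hden t ht, div_eq_iff (div_ne_zero hΔ h1), ← mul_div_assoc t, eq_div_iff h1, Δ]
    linear_combination k.d * h2
  -- `ρ` is the inverse fractional linear map; describing the image as a preimage under it yields
  -- openness.
  have hI : τ '' J = {s | k.a - k.c * s ≠ 0} ∩ ρ ⁻¹' J := by
    ext s
    constructor
    · rintro ⟨t, ht, rfl⟩
      exact ⟨hden0 t ht, by rw [Set.mem_preimage, hρτ t ht]; exact ht⟩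
    · rintro ⟨h0, h1⟩
      refine ⟨ρ s, h1, ?_⟩
      have h2 := hs _ h1
      have h3 : k.a - k.c * s ≠ 0 := h0
      have h4 : k.c * ρ s + k.d = k.Δ / (k.a - k.c * s) := by
        simp only [hρ, Δ]; field_simp; ring
      have h5 : ρ s * (k.a - k.c * s) = k.d * s - k.b := div_mul_cancel₀ _ h3
      change (k.a * ρ s + k.b) / (k.c * ρ s + k.d) = s
      rw [h4, div_eq_iff (div_ne_zero hΔ h3), ← mul_div_assoc s, eq_div_iff h3, Δ]
      linear_combination k.a * h5
  have hρs : ContDiffOn ℝ ∞ ρ {s | k.a - k.c * s ≠ 0} :=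
    ContDiffOn.div (by fun_prop) (by fun_prop) fun s hs => hs
  have hopen : IsOpen (τ '' J) := by
    rw [hI]
    exact hρs.continuousOn.isOpen_inter_preimage
      (isOpen_ne_fun (by fun_prop) continuous_const) hJ
  have hτc : ContinuousOn τ J := ContinuousOn.div (by fun_prop) (by fun_prop) hs
  have hρI : ContDiffOn ℝ ∞ ρ (τ '' J) := hρs.mono (by rw [hI]; exact Set.inter_subset_left)
  have hmaps : Set.MapsTo ρ (τ '' J) J := by
    rintro _ ⟨t, ht, rfl⟩; rw [hρτ t ht]; exact ht
  have hsI : ∀ s ∈ τ '' J, k.c * ρ s + k.d ≠ 0 := fun s h => hs _ (hmaps h)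
  have hlin : ContDiffOn ℝ ∞ (fun s => k.c * ρ s + k.d) (τ '' J) :=
    (contDiffOn_const.mul hρI).add contDiffOn_const
  refine ⟨⟨τ '' J, fun s => k.e₂ ^ 3 / (k.c * ρ s + k.d) * (E.β (ρ s) / k.Δ),
    fun s => k.e₂ ^ 5 / (k.c * ρ s + k.d) ^ 3 * (E.σ (ρ s) / k.Δ), hopen,
    (hJc.image τ hτc).ordConnected, hJn.image τ, ?_, ?_, fun s h => ?_, fun s h => ?_⟩,
    fun t ht => ⟨⟨t, ht, rfl⟩, ?_, ?_⟩⟩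
  · exact (contDiffOn_const.div hlin hsI).mul
      ((E.smooth_β.comp hρI (hmaps.mono_right hJE)).div_const _)
  · exact (contDiffOn_const.div (hlin.pow 3) fun s h => pow_ne_zero 3 (hsI s h)).mul
      ((E.smooth_σ.comp hρI (hmaps.mono_right hJE)).div_const _)
  · exact mul_ne_zero (div_ne_zero (pow_ne_zero 3 he) (hsI s h))
      (div_ne_zero (E.β_ne_zero _ (hJE (hmaps h))) hΔ)
  · exact mul_ne_zero (div_ne_zero (pow_ne_zero 5 he) (pow_ne_zero 3 (hsI s h)))
      (div_ne_zero (E.σ_ne_zero _ (hJE (hmaps h))) hΔ)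
  · change k.e₂ ^ 3 / (k.c * ρ (τ t) + k.d) * (E.β (ρ (τ t)) / k.Δ) = _
    rw [hρτ t ht]
  · change k.e₂ ^ 5 / (k.c * ρ (τ t) + k.d) ^ 3 * (E.σ (ρ (τ t)) / k.Δ) = _
    rw [hρτ t ht]

/-- The new left-hand side is the old one times `e₂ (ct + d)^3 / Δ^2`. The affine part of `U` in `x`
does not affect the third and fifth derivatives. -/
theorem Describes.lhs_iff (h : k.Describes Φ Ω) (hΩ : IsOpen Ω) {E E' : Equation} {q : ℝ × ℝ}
    {u v : ℝ × ℝ → ℝ} (hp : (q.1, q.2, u q) ∈ Ω) (hv : Φ.MapsJet u v q)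
    (hβ : E'.β (Φ.T (q.1, q.2, u q)) = k.e₂ ^ 3 / (k.c * q.1 + k.d) * (E.β q.1 / k.Δ))
    (hσ : E'.σ (Φ.T (q.1, q.2, u q)) = k.e₂ ^ 5 / (k.c * q.1 + k.d) ^ 3 * (E.σ q.1 / k.Δ)) :
    E.lhs u q = 0 ↔ E'.lhs v (Φ.newIndep u q) = 0 := by
  obtain ⟨hTt, hTx, hTu⟩ := h.partials_T hΩ hp
  obtain ⟨hXt, hXx, hXu⟩ := h.partials_X hΩ hp
  obtain ⟨hUt, hUx, hUu⟩ := h.partials_U hΩ hp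
  obtain ⟨hs, hT, hX, hU, -⟩ := h.2.2 _ _ _ hp
  have hΔ := h.1
  have he := h.2.1
  have hmem : ∀ᶠ z in 𝓝 (q.2, u q), (q.1, z) ∈ Ω :=
    eventually_slice_mem hΩ hp
  set g : ℝ → ℝ := fun y => (-(k.e₂ * k.c * y) - k.e₀ * k.c + k.e₁ * k.d) / k.Δ with hg
  obtain ⟨vt, vx, v₃, v₅, h0, h1, h2, h3, h5⟩ := hv.prolong (g := g)
    ((h.contDiffAt_T hΩ hp).differentiableAt (by simp))
    ((h.contDiffAt_X hΩ hp).differentiableAt (by simp))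
    ((h.contDiffAt_U hΩ hp).differentiableAt (by simp)) hTx hTu hXu
    (hmem.mono fun z hz => by rw [(h.2.2 _ z.1 z.2 hz).2.1, hT])
    (hmem.mono fun z hz => by
      rw [(h.2.2 _ z.1 z.2 hz).2.2.1, hX, hXx]
      field_simp; ring)
    (hmem.mono fun z hz => by
      rw [(h.2.2 _ z.1 z.2 hz).2.2.2.1, hUu]
      simp only [hg]
      field_simp; ring)
    (by fun_prop)
  have hg' : g = fun y => g q.2 + -(k.e₂ * k.c / k.Δ) * (y - q.2) + 0 * (y - q.2) ^ 2 +
      0 * (y - q.2) ^ 3 + 0 * (y - q.2) ^ 4 + 0 * (y - q.2) ^ 5 := by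
    funext y; simp only [hg]; ring
  obtain ⟨-, g3, g5⟩ := iteratedDeriv_quintic (g q.2) (-(k.e₂ * k.c / k.Δ)) 0 0 0 q.2
  rw [← hg'] at g3 g5
  rw [g3, mul_zero, add_zero, hXx, hUu] at h3
  rw [g5, mul_zero, add_zero, hXx, hUu] at h5
  rw [hXx, hUx, hUu] at h2
  rw [hTt, hXt, hUt, hUu] at h1
  rw [h0, hβ, hσ, hU, Equation.lhs]
  set s := k.c * q.1 + k.d with hs_def
  have hvx : vx = s / k.e₂ * (-(k.e₂ * k.c) / k.Δ +
      deriv (fun y => u (q.1, y)) q.2 * (k.e₂ * s / k.Δ)) := by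
    rw [← h2]; field_simp
  have hv3 : v₃ = (s / k.e₂) ^ 3 * (k.e₂ * s / k.Δ *
      iteratedDeriv 3 (fun y => u (q.1, y)) q.2) := by
    rw [← h3]; field_simp
  have hv5 : v₅ = (s / k.e₂) ^ 5 * (k.e₂ * s / k.Δ *
      iteratedDeriv 5 (fun y => u (q.1, y)) q.2) := by
    rw [← h5]; field_simp
  have hvt : vt = s ^ 2 / k.Δ * (k.e₂ * k.c * u q / k.Δ +
      deriv (fun r => u (r, q.2)) q.1 * (k.e₂ * s / k.Δ) -
      (k.e₁ * s - k.c * (k.e₂ * q.2 + k.e₁ * q.1 + k.e₀)) / s ^ 2 * vx) := by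
    rw [← h1]; field_simp; ring
  have hmain : vt + (k.e₂ * s * u q - k.e₂ * k.c * q.2 - k.e₀ * k.c + k.e₁ * k.d) / k.Δ * vx +
      k.e₂ ^ 3 / s * (E.β q.1 / k.Δ) * v₃ + k.e₂ ^ 5 / s ^ 3 * (E.σ q.1 / k.Δ) * v₅ =
      k.e₂ * s ^ 3 / k.Δ ^ 2 * (deriv (fun s => u (s, q.2)) q.1 +
        u q * deriv (fun y => u (q.1, y)) q.2 +
        E.β q.1 * iteratedDeriv 3 (fun y => u (q.1, y)) q.2 +
        E.σ q.1 * iteratedDeriv 5 (fun y => u (q.1, y)) q.2) := by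
    rw [hvt, hv3, hv5, hvx]
    have hd : k.d = s - k.c * q.1 := by rw [hs_def]; ring
    field_simp
    rw [hd]
    ring
  rw [hmain, mul_eq_zero]
  have hne : k.e₂ * s ^ 3 / k.Δ ^ 2 ≠ 0 :=
    div_ne_zero (mul_ne_zero he (pow_ne_zero 3 hs)) (pow_ne_zero 2 hΔ)
  exact ⟨fun h => Or.inr h, fun h => h.resolve_left hne⟩

/-- Connectedness makes the projection of `Ω` to the `t`-axis an interval on which `ct + d` does not
vanish, so the image equation lives on the image of an interval. -/
theorem Describes.isUsualEquivalence (h : k.Describes Φ Ω) (hΩ : IsOpen Ω)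
    (hconn : IsConnected Ω) : Φ.IsUsualEquivalence Ω := by
  refine ⟨h.isNondegenerate hΩ, fun E => ?_⟩
  have hPo : IsOpen (Prod.fst '' Ω) := isOpenMap_fst _ hΩ
  have hPc : (Prod.fst '' Ω).OrdConnected :=
    (hconn.isPreconnected.image _ continuous_fst.continuousOn).ordConnected
  by_cases hn : (E.I ∩ Prod.fst '' Ω).Nonempty
  · obtain ⟨E', hE'⟩ := exists_image_equation h.1 h.2.1 E (E.isOpen_I.inter hPo)
      (E.ordConnected_I.inter hPc).isPreconnected hn Set.inter_subset_left (by
        rintro _ ⟨-, ⟨t, x, u⟩, hp, rfl⟩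
        exact (h.2.2 t x u hp).1)
    have key : ∀ p ∈ Ω, p.1 ∈ E.I → Φ.T p ∈ E'.I ∧
        E'.β (Φ.T p) = k.e₂ ^ 3 / (k.c * p.1 + k.d) * (E.β p.1 / k.Δ) ∧
        E'.σ (Φ.T p) = k.e₂ ^ 5 / (k.c * p.1 + k.d) ^ 3 * (E.σ p.1 / k.Δ) := by
      intro p hp hpE
      rw [(h.2.2 p.1 p.2.1 p.2.2 hp).2.1]
      exact hE' p.1 ⟨hpE, p, hp, rfl⟩
    refine ⟨E', fun p hp hpE => ?_, fun q u v hqE hp hv => ?_⟩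
    · obtain ⟨h1, h2, h3⟩ := key p hp hpE
      obtain ⟨h4, h5⟩ := (h.2.2 p.1 p.2.1 p.2.2 hp).2.2.2.2 _ _ (E.β_ne_zero _ hpE)
        (E.σ_ne_zero _ hpE)
      exact ⟨h1, h2.trans h4.symm, h3.trans h5.symm⟩
    · obtain ⟨-, h2, h3⟩ := key _ hp hqE
      exact h.lhs_iff hΩ hp hv h2 h3
  -- No time of `E` occurs in `Ω`, so any equation would serve.
  · refine ⟨E, fun p hp hpE => absurd ⟨p.1, hpE, p, hp, rfl⟩ hn, fun q u v hqE hp hv =>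
      absurd ⟨q.1, hqE, (q.1, q.2, u q), hp, rfl⟩ hn⟩

end Equivalence

end Params

end Kawahara

theorem corollary2 (Ω : Set (ℝ × ℝ × ℝ)) (hΩ : IsOpen Ω) (hconn : IsConnected Ω)
    (Φ : Kawahara.Transformation) :
    (Φ.IsUsualEquivalence Ω ↔ ∃ k : Kawahara.Params, k.Describes Φ Ω) ∧
    (∀ k : Kawahara.Params, k.Describes Φ Ω →
      ∀ k' : Kawahara.Params,
        k'.Describes Φ Ω ↔ ∃ m : ℝ, m ≠ 0 ∧ k' = Kawahara.Params.scale m k) ∧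
    (Φ.IsUsualEquivalence Ω ↔
      ∃ k : Kawahara.Params, (k.Δ = 1 ∨ k.Δ = -1) ∧ k.Describes Φ Ω) := by
  refine ⟨⟨fun h => h.exists_describes hΩ hconn, fun ⟨k, hk⟩ => hk.isUsualEquivalence hΩ hconn⟩,
    fun k hk k' => ⟨fun hk' => hk.eq_scale hk' hΩ hconn.nonempty, ?_⟩, fun h => ?_,
    fun ⟨k, _, hk⟩ => hk.isUsualEquivalence hΩ hconn⟩
  · rintro ⟨m, hm, rfl⟩
    exact hk.scale hm
  · obtain ⟨k, hk⟩ := h.exists_describes hΩ hconn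
    exact hk.exists_normalized
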